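/- Consider the Propp machine on $\mathbb{Z}$. A configuration consists of a number $f(x)\in\{0,1,2,\dots\}$ of chips and an arrow (pointing right or left) at every vertex $x\in\mathbb{Z}$. In each time step every vertex sends away all its chips, alternately to its right and its left neighbour, the first one in the direction of its arrow, the arrow being flipped once for each chip sent. For a starting configuration (at time $0$) let $f(x,t)$ be the number of chips at $x$ at time $t$, and let $E(x,t)$ be the expected number of chips at $x$ at time $t$ if instead every chip of the starting configuration performs a simple random walk. A configuration is *even* (*odd*) if it has no chip at an odd (even) position. For a finite $X\subset\mathbb{Z}$ put $\mathrm{disc}(X,t)=\sum_{x\in X}\bigl(f(x,t)-E(x,t)\bigr)$. An interval of length $L$ is a set of $L$ consecutive integers. **Theorem.** (i) There is an absolute constant $C>0$ such that for all integers $L\ge 2$ and $M>L^6$, every even or odd starting configuration, every time $t\ge 0$ and every interval $X$ of length $L$, $$\frac1M\sum_{k=1}^M \mathrm{disc}^2(X+k,t)\le C\log L ,\qquad\text{and}\qquad \Bigl(\frac1M\sum_{k=1}^M \mathrm{disc}^2(X+k,t)\Bigr)^{1/2}\le C\sqrt{\log L}.$$ (ii) There is an absolute constant $\kappa>0$ such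 that for all integers $L\ge1$ and $M\ge1$ there are an even starting configuration, a time $t\ge 0$ and an interval $X$ of length $L$ with $$\frac1M\sum_{k=1}^M \mathrm{disc}^2(X+k,t)\ge \kappa\log L .$$ -/

import Mathlib

namespace ProppMachine

/-- A configuration of the Propp machine on the integers: the number of chips on each vertex, and
the arrow of each vertex (`1` points to the right, `-1` points to the left). -/
structure Config where
  chips : ℤ → ℕ
  arr : ℤ → ℤˣ

/-- The number of chips that the vertex `y` sends to `y + 1` in one step. The chips leave
alternately to the right and to the left, the first one in the direction of the arrow. -/
def Config.sentRight (c : Config) (y : ℤ) : ℕ :=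
  if c.arr y = 1 then (c.chips y + 1) / 2 else c.chips y / 2

/-- The number of chips that the vertex `y` sends to `y - 1` in one step. -/
def Config.sentLeft (c : Config) (y : ℤ) : ℕ :=
  if c.arr y = 1 then c.chips y / 2 else (c.chips y + 1) / 2

/-- One step of the Propp machine. The arrow of a vertex is flipped once for each chip there. -/
def Config.step (c : Config) : Config where
  chips x := c.sentRight (x - 1) + c.sentLeft (x + 1)
  arr x := (-1) ^ c.chips x * c.arr x

/-- The configuration after `t` steps of the Propp machine started at `c`. -/
def Config.run (c : Config) : ℕ → Config
  | 0 => c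
  | t + 1 => (c.run t).step

/-- An even configuration: no chip is at an odd position. -/
def Config.IsEven (c : Config) : Prop := ∀ x : ℤ, Odd x → c.chips x = 0

/-- An odd configuration: no chip is at an even position. -/
def Config.IsOdd (c : Config) : Prop := ∀ x : ℤ, Even x → c.chips x = 0

/-- `H x t`: the probability that a simple random walk from the origin is at `x` at time `t`, that
is, the proportion of the `2 ^ t` sequences of `t` steps `1` or `-1` whose sum is `x`. -/
noncomputable def H (x : ℤ) (t : ℕ) : ℝ :=
  (Finset.univ.filter fun s : Fin t → ℤˣ => ∑ i, (s i : ℤ) = x).card / 2 ^ t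

/-- `c.E x t`: the expected number of chips at `x` after every chip of `c` has performed a simple
random walk of `t` steps. Only the chips at distance at most `t` from `x` can reach `x`. -/
noncomputable def Config.E (c : Config) (x : ℤ) (t : ℕ) : ℝ :=
  ∑ y ∈ Finset.Icc (x - t) (x + t), (c.chips y : ℝ) * H (x - y) t

/-- The discrepancy of a finite set `X` of vertices at time `t`. -/
noncomputable def Config.disc (c : Config) (X : Finset ℤ) (t : ℕ) : ℝ :=
  ∑ x ∈ X, ((c.run t).chips x : ℝ) - ∑ x ∈ X, c.E x t

/-- The interval `[a..a+L-1]` of length `L`, that is, with `L` vertices. -/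
noncomputable def interval (a : ℤ) (L : ℕ) : Finset ℤ := Finset.Icc a (a + L - 1)

/-- The translate `X + k`. -/
def translate (X : Finset ℤ) (k : ℤ) : Finset ℤ := X.image fun x => x + k

/-- The average of the squared discrepancies of `X + 1, …, X + M` at time `t`. -/
noncomputable def Config.meanSqDisc (c : Config) (X : Finset ℤ) (M t : ℕ) : ℝ :=
  1 / (M : ℝ) * ∑ k ∈ Finset.Icc (1 : ℕ) M, c.disc (translate X (k : ℤ)) t ^ 2

/-- The step of the machine in the usual form, with halves and parities. -/
theorem Config.step_chips (c : Config) (x : ℤ) :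
    (c.step.chips x : ℝ) = (c.chips (x - 1) : ℝ) / 2 + (c.chips (x + 1) : ℝ) / 2
      + ((c.arr (x - 1) : ℤ) : ℝ) * ((c.chips (x - 1) % 2 : ℕ) : ℝ) / 2
      - ((c.arr (x + 1) : ℤ) : ℝ) * ((c.chips (x + 1) % 2 : ℕ) : ℝ) / 2 := by
  have hR : ∀ y, (c.sentRight y : ℝ)
      = (c.chips y : ℝ) / 2 + ((c.arr y : ℤ) : ℝ) * ((c.chips y % 2 : ℕ) : ℝ) / 2 := by
    intro y
    have h1 : (c.chips y : ℝ) = 2 * ((c.chips y / 2 : ℕ) : ℝ) + ((c.chips y % 2 : ℕ) : ℝ) := by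
      exact_mod_cast (Nat.div_add_mod _ _).symm
    have h2 : (c.chips y + 1) / 2 = c.chips y / 2 + c.chips y % 2 := by omega
    rcases Int.units_eq_one_or (c.arr y) with h | h
    · simp only [Config.sentRight, h, if_true, h2]
      push_cast at h1 ⊢
      linarith
    · have hne : ¬ ((-1 : ℤˣ) = 1) := by decide
      simp only [Config.sentRight, h, if_neg hne]
      push_cast at h1 ⊢
      linarith
  have hL : ∀ y, (c.sentLeft y : ℝ)
      = (c.chips y : ℝ) / 2 - ((c.arr y : ℤ) : ℝ) * ((c.chips y % 2 : ℕ) : ℝ) / 2 := by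
    intro y
    have h1 : (c.sentRight y : ℝ) + c.sentLeft y = c.chips y := by
      have : c.sentRight y + c.sentLeft y = c.chips y := by
        unfold Config.sentRight Config.sentLeft
        split_ifs <;> omega
      exact_mod_cast this
    linarith [hR y]
  simp only [Config.step, Nat.cast_add, hR, hL]
  ring

theorem H_eq_zero (x : ℤ) (t : ℕ) (h : (t : ℤ) < |x|) : H x t = 0 := by
  have : (Finset.univ.filter fun s : Fin t → ℤˣ => ∑ i, (s i : ℤ) = x) = ∅ := by
    refine Finset.filter_eq_empty_iff.2 fun s _ hs => ?_
    have h1 : |∑ i, (s i : ℤ)| ≤ ∑ i : Fin t, |(s i : ℤ)| := Finset.abs_sum_le_sum_abs _ _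
    have h2 : ∑ i : Fin t, |(s i : ℤ)| = t := by
      have : ∀ i : Fin t, |(s i : ℤ)| = 1 := fun i => by
        rcases Int.units_eq_one_or (s i) with h | h <;> simp [h]
      simp [this]
    rw [hs] at h1
    omega
  simp [H, this]

theorem H_succ (x : ℤ) (t : ℕ) : H x (t + 1) = (H (x - 1) t + H (x + 1) t) / 2 := by
  have key : ∀ (u : ℕ) (z : ℤ), (((Finset.univ.filter
      fun s : Fin u → ℤˣ => ∑ i, (s i : ℤ) = z).card : ℕ) : ℝ)
      = ∑ s : Fin u → ℤˣ, if ∑ i, (s i : ℤ) = z then (1 : ℝ) else 0 := by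
    intro u z
    simp
  have huniv : (Finset.univ : Finset ℤˣ) = {1, -1} := by decide
  unfold H
  rw [key, key, key, ← (Fin.consEquiv fun _ : Fin (t + 1) => ℤˣ).sum_comp, Fintype.sum_prod_type,
    huniv, Finset.sum_pair (by decide)]
  simp only [Fin.consEquiv_apply, Fin.sum_univ_succ, Fin.cons_zero, Fin.cons_succ, Units.val_one,
    Units.val_neg]
  have h1 : ∀ a : ℤ, (1 + a = x) ↔ (a = x - 1) := fun a => by omega
  have h2 : ∀ a : ℤ, (-1 + a = x) ↔ (a = x + 1) := fun a => by omega
  simp only [h1, h2, pow_succ]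
  field_simp

/-- The expected numbers of chips are those of the linear machine: it starts with the chips of `c`
and in each step every vertex sends half of its chips to each neighbour. -/
theorem Config.E_zero (c : Config) (x : ℤ) : c.E x 0 = c.chips x := by
  simp [Config.E, H]

theorem Config.E_succ (c : Config) (x : ℤ) (t : ℕ) :
    c.E x (t + 1) = c.E (x - 1) t / 2 + c.E (x + 1) t / 2 := by
  have ext : ∀ z : ℤ, |z - x| ≤ 1 → c.E z t
      = ∑ y ∈ Finset.Icc (x - (t + 1 : ℕ)) (x + (t + 1 : ℕ)), (c.chips y : ℝ) * H (z - y) t := by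
    intro z hz
    rw [abs_le] at hz
    refine Finset.sum_subset (Finset.Icc_subset_Icc (by push_cast; omega) (by push_cast; omega)) ?_
    intro y _ hy
    rw [H_eq_zero, mul_zero]
    simp only [Finset.mem_Icc, not_and_or, not_le] at hy
    rw [lt_abs]
    omega
  rw [ext (x - 1) (by simp), ext (x + 1) (by simp), Finset.sum_div, Finset.sum_div,
    ← Finset.sum_add_distrib]
  refine Finset.sum_congr rfl fun y _ => ?_
  rw [H_succ, show x - y - 1 = x - 1 - y by ring, show x - y + 1 = x + 1 - y by ring]
  ring

end ProppMachine

/-!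
The difference between the machine and the expectation obeys the same linear recursion as the
expectation, with a source term: in each step an odd number of chips at `y` makes `y` send half a
chip too much in the direction of its arrow. This source is `Config.turn`, half the decrease of the
arrow, so for fixed `y` the sources over time telescope and their partial sums stay bounded. Spread
by the random walk until the final time they add up to `Config.potential`; the discrepancy at `x` is
half a difference of two values of the potential (`Config.run_sub_E`), and that of an interval is a
combination of its values near the two ends (`sum_interval_sub`).

*Upper bound.* It suffices to treat `L` consecutive translates (`Config.sum_disc_sq_block_le`). The
vertices at distance more than `L` contribute `O(1)` to each discrepancy, since by summation by parts
a vertex at distance `d` contributes at most the variation in time of `H (d - 1) - H (d + 1)`, which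
is `O(1 / d ^ 2)`. The squared potential of the `4 * L` remaining vertices is summed over all places.
A walk followed by a walk is a walk (`sum_H_mul_H`), so the pair `y, y'` contributes a double sum of
`H (y - y')` over sums of two times, with coefficients that telescope in both variables; by double
summation by parts it is `O(1 / (1 + |y - y'|))` (`abs_sum_sum_H_le`). The sum over all pairs is
`O(L log L)`. Both estimates of variations come from the rational recursion `H_add_two`, by which
`H d v` and `H d v / v` are unimodal in `v` and which expresses the weighted second difference of
`H d v` through first differences of these two functions, and from the local bound
`H_local_bound`.

*Lower bound.* In an even configuration the arrows at a finite set of vertices and times can be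
prescribed freely, subject to parity (`exists_config_arr`). Arrows of even vertices are turned at the
remaining times `48 ^ (2 * i)` and `0`, with signs that are constant on blocks of a length between
the square roots of successive times. The kernel with which the sign of a block enters the
discrepancy is the difference of the walks at two successive scale times: the shorter walk stays
within three blocks with probability at least `3 / 4`, and the longer one is there with probability
at most `1 / 4` (`sum_kernel_le`). Hence every scale contributes a constant to the sum of the squared
coefficients of the signs, for each translate, as long as the scale time is at most `L / 2`; there are
of the order of `log L` such scales. Signs chosen greedily make the sum over the translates of the
squared discrepancies at least the sum of the squared coefficients (`exists_signs`).
-/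

namespace ProppMachine

/-! ### The distribution of the simple random walk -/

theorem H_zero (x : ℤ) : H x 0 = if x = 0 then 1 else 0 := by
  by_cases h : x = 0
  · simp [H, h]
  · simp [H, h, Ne.symm h]

theorem H_nonneg (x : ℤ) (t : ℕ) : 0 ≤ H x t := by
  unfold H; positivity

theorem H_neg (x : ℤ) (t : ℕ) : H (-x) t = H x t := by
  induction t generalizing x with
  | zero => simp [H_zero]
  | succ t ih =>
    rw [H_succ, H_succ, show -x - 1 = -(x + 1) by ring, show -x + 1 = -(x - 1) by ring, ih, ih]
    ring

theorem H_abs (x : ℤ) (t : ℕ) : H |x| t = H x t := by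
  rcases abs_choice x with h | h <;> rw [h]
  exact H_neg x t

theorem H_le_one (x : ℤ) (t : ℕ) : H x t ≤ 1 := by
  induction t generalizing x with
  | zero => rw [H_zero]; split_ifs <;> norm_num
  | succ t ih => rw [H_succ]; linarith [ih (x - 1), ih (x + 1)]

theorem H_eq_zero_of_odd (x : ℤ) (t : ℕ) (h : Odd (x + t)) : H x t = 0 := by
  induction t generalizing x with
  | zero =>
    rw [H_zero, if_neg]
    rintro rfl
    simp at h
  | succ t ih =>
    rw [Int.odd_iff] at h
    rw [H_succ, ih, ih]
    · simp
    all_goals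
      rw [Int.odd_iff]
      push_cast at h
      omega

/-- Neighbouring values of the binomial distribution have a rational quotient. -/
theorem H_ratio (x : ℤ) (t : ℕ) :
    ((t : ℝ) + 1 + x) * H (x + 1) t = ((t : ℝ) + 1 - x) * H (x - 1) t := by
  induction t generalizing x with
  | zero =>
    rw [H_zero, H_zero]
    rcases eq_or_ne x 1 with rfl | h1
    · norm_num
    rcases eq_or_ne x (-1) with rfl | h2
    · norm_num
    rw [if_neg (by omega), if_neg (by omega)]
    simp
  | succ t ih =>
    have h1 := ih (x + 1)
    have h2 := ih (x - 1)
    rw [H_succ, H_succ]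
    rw [show x + 1 + 1 = x + 2 by ring, show x + 1 - 1 = x by ring] at *
    rw [show x - 1 + 1 = x by ring, show x - 1 - 1 = x - 2 by ring] at *
    push_cast at *
    linarith

theorem H_succ_left (x : ℤ) (t : ℕ) :
    ((t : ℝ) + 1 + x) * H x (t + 1) = ((t : ℝ) + 1) * H (x - 1) t := by
  have := H_ratio x t
  rw [H_succ]
  linarith

theorem H_succ_right (x : ℤ) (t : ℕ) :
    ((t : ℝ) + 1 - x) * H x (t + 1) = ((t : ℝ) + 1) * H (x + 1) t := by
  have := H_ratio x t
  rw [H_succ]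
  linarith

/-- The values at one place are related by a rational recursion in time. -/
theorem H_add_two (d : ℤ) (v : ℕ) :
    ((v : ℝ) + 1) * (v + 2) * H d v = (((v : ℝ) + 2) ^ 2 - (d : ℝ) ^ 2) * H d (v + 2) := by
  have h1 := H_succ_left d (v + 1)
  have h2 := H_succ_right (d - 1) v
  rw [show d - 1 + 1 = d by ring] at h2
  push_cast at h1 h2
  linear_combination (-(v + 2 - d) : ℝ) * h1 - (v + 2 : ℝ) * h2

/-- A discrete spatial derivative of `H` is a value of `H` at the next time. -/
theorem H_sub_H (z : ℤ) (u : ℕ) :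
    H (z - 1) u - H (z + 1) u = 2 * z * (H z (u + 1) / (u + 1 : ℕ)) := by
  have h1 := H_succ_left z u
  have h2 := H_succ_right z u
  push_cast
  field_simp
  linarith

theorem H_le_center (z v : ℕ) : H z v ≤ H 0 v + H 1 v := by
  induction z using Nat.twoStepInduction with
  | zero => simpa using H_nonneg 1 v
  | one => simpa using H_nonneg 0 v
  | more n ih _ =>
    refine le_trans ?_ ih
    have h := H_ratio (n + 1) v
    rw [show (n : ℤ) + 1 + 1 = n + 2 by ring, show (n : ℤ) + 1 - 1 = n by ring] at h
    push_cast at h ⊢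
    have hp : (0 : ℝ) < v + 1 + (n + 1) := by positivity
    have h0 := H_nonneg n v
    nlinarith

theorem H_center_sq (v : ℕ) : ((v : ℝ) + 1) * H 0 v ^ 2 ≤ 1 := by
  induction v using Nat.twoStepInduction with
  | zero => simp [H_zero]
  | one => rw [H_eq_zero_of_odd] <;> simp
  | more n ih _ =>
    have h := H_add_two 0 n
    have h' : ((n : ℝ) + 2) * H 0 (n + 2) = (n + 1) * H 0 n := by
      have : (n : ℝ) + 2 ≠ 0 := by positivity
      apply mul_left_cancel₀ this
      push_cast at h
      linarith
    have h2 : H 0 (n + 2) = (n + 1) * H 0 n / (n + 2) := by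
      field_simp
      linarith
    refine le_trans ?_ ih
    rw [h2]
    push_cast
    rw [div_pow, mul_pow, ← mul_div_assoc, div_le_iff₀ (by positivity)]
    have : 0 ≤ ((n : ℝ) + 1) * H 0 n ^ 2 := by positivity
    nlinarith

/-- The local bound `H z v ≤ 2 / √(v + 1)`. -/
theorem H_local_bound (z : ℤ) (v : ℕ) : ((v : ℝ) + 1) * H z v ^ 2 ≤ 4 := by
  have h1 : H 0 (v + 1) = H 1 v := by
    rw [H_succ, show (0 : ℤ) - 1 = -1 by ring, H_neg, zero_add]
    ring
  have h2 : H z v ≤ H 0 v + H 1 v := by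
    rw [← H_abs, Int.abs_eq_natAbs]
    exact H_le_center _ _
  have h3 := H_center_sq v
  have h4 := H_center_sq (v + 1)
  rw [h1] at h4
  push_cast at h4
  have h5 : H z v ^ 2 ≤ (H 0 v + H 1 v) ^ 2 := pow_le_pow_left₀ (H_nonneg _ _) h2 2
  have h6 : 0 ≤ (v : ℝ) := by positivity
  calc ((v : ℝ) + 1) * H z v ^ 2 ≤ (v + 1) * (H 0 v + H 1 v) ^ 2 := by gcongr
    _ ≤ (v + 1) * (2 * H 0 v ^ 2 + 2 * H 1 v ^ 2) := by
        gcongr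
        nlinarith [sq_nonneg (H 0 v - H 1 v)]
    _ ≤ 4 := by nlinarith [sq_nonneg (H 1 v)]

/-- A sum of translates of `H` in one of which the walk takes one step more. -/
theorem sum_mul_H_succ (S : Finset ℤ) (y : ℤ) (u : ℕ) (w : ℤ → ℝ) :
    ∑ b ∈ S, w b * H (b - y) (u + 1)
      = (∑ b ∈ S, w b * H (b - (y + 1)) u + ∑ b ∈ S, w b * H (b - (y - 1)) u) / 2 := by
  rw [← Finset.sum_add_distrib, Finset.sum_div]
  refine Finset.sum_congr rfl fun b _ => ?_
  rw [H_succ, show b - y - 1 = b - (y + 1) by ring, show b - y + 1 = b - (y - 1) by ring]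
  ring

/-- A walk of `u` steps followed by one of `u'` steps is a walk of `u + u'` steps. -/
theorem sum_H_mul_H (S : Finset ℤ) (y y' : ℤ) (u u' : ℕ) (hS : Finset.Icc (y - u) (y + u) ⊆ S) :
    ∑ b ∈ S, H (b - y') u' * H (b - y) u = H (y - y') (u + u') := by
  induction u generalizing y with
  | zero =>
    have hy : y ∈ S := hS (by simp)
    simp only [H_zero, sub_eq_zero, mul_ite, mul_one, mul_zero, Finset.sum_ite_eq', hy, if_true,
      zero_add]
  | succ u ih =>
    rw [sum_mul_H_succ, ih (y + 1), ih (y - 1), show u + 1 + u' = u + u' + 1 by ring, H_succ,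
      show y + 1 - y' = y - y' + 1 by ring, show y - 1 - y' = y - y' - 1 by ring]
    · ring
    · refine (Finset.Icc_subset_Icc ?_ ?_).trans hS <;> push_cast <;> omega
    · refine (Finset.Icc_subset_Icc ?_ ?_).trans hS <;> push_cast <;> omega

theorem sum_H (S : Finset ℤ) (y : ℤ) (u : ℕ) (hS : Finset.Icc (y - u) (y + u) ⊆ S) :
    ∑ b ∈ S, H (b - y) u = 1 := by
  induction u generalizing y with
  | zero =>
    have hy : y ∈ S := hS (by simp)
    simp [H_zero, sub_eq_zero, hy]
  | succ u ih =>
    have h := sum_mul_H_succ S y u 1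
    simp only [Pi.one_apply, one_mul] at h
    rw [h, ih (y + 1), ih (y - 1)]
    · ring
    · refine (Finset.Icc_subset_Icc ?_ ?_).trans hS <;> push_cast <;> omega
    · refine (Finset.Icc_subset_Icc ?_ ?_).trans hS <;> push_cast <;> omega

/-- The second moment of the walk about an arbitrary point `p`. -/
theorem sum_sq_mul_H (S : Finset ℤ) (p y : ℤ) (u : ℕ) (hS : Finset.Icc (y - u) (y + u) ⊆ S) :
    ∑ b ∈ S, ((b : ℝ) - p) ^ 2 * H (b - y) u = ((y : ℝ) - p) ^ 2 + u := by
  induction u generalizing y with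
  | zero =>
    have hy : y ∈ S := hS (by simp)
    simp [H_zero, sub_eq_zero, hy]
  | succ u ih =>
    rw [sum_mul_H_succ S y u, ih (y + 1), ih (y - 1)]
    · push_cast
      ring
    · refine (Finset.Icc_subset_Icc ?_ ?_).trans hS <;> push_cast <;> omega
    · refine (Finset.Icc_subset_Icc ?_ ?_).trans hS <;> push_cast <;> omega

/-! ### Variation in time of the transition probabilities -/

/-- A nonnegative sequence that increases up to the index `J` and decreases from then on has its
maximum at `J`, and its total variation is at most twice the maximum. -/
theorem unimodal_bound (a : ℕ → ℝ) (J : ℕ) (h0 : ∀ j, 0 ≤ a j)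
    (hup : ∀ j < J, a j ≤ a (j + 1)) (hdown : ∀ j, J ≤ j → a (j + 1) ≤ a j) :
    (∀ j, a j ≤ a J) ∧ ∀ N, ∑ j ∈ Finset.range N, |a (j + 1) - a j| ≤ 2 * a J := by
  have hup' : ∀ N ≤ J, ∑ j ∈ Finset.range N, |a (j + 1) - a j| = a N - a 0 := by
    intro N hN
    rw [← Finset.sum_range_sub]
    refine Finset.sum_congr rfl fun j hj => abs_of_nonneg ?_
    rw [Finset.mem_range] at hj
    linarith [hup j (by omega)]
  have hdown' : ∀ k, ∑ j ∈ Finset.range k, |a (J + j + 1) - a (J + j)| = a J - a (J + k) := by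
    intro k
    induction k with
    | zero => simp
    | succ k ih =>
      rw [Finset.sum_range_succ, ih, abs_of_nonpos (by linarith [hdown (J + k) (by omega)])]
      rw [← add_assoc]
      ring
  have hmax : ∀ j, a j ≤ a J := by
    intro j
    rcases le_total j J with h | h
    · have h1 := hup' j h
      have h2 := hup' J le_rfl
      have h3 : ∑ i ∈ Finset.range j, |a (i + 1) - a i| ≤ ∑ i ∈ Finset.range J, |a (i + 1) - a i| :=
        Finset.sum_le_sum_of_subset_of_nonneg (by simpa using h) fun _ _ _ => abs_nonneg _
      linarith
    · obtain ⟨k, rfl⟩ := Nat.exists_eq_add_of_le h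
      have h1 := hdown' k
      have h2 : 0 ≤ ∑ j ∈ Finset.range k, |a (J + j + 1) - a (J + j)| :=
        Finset.sum_nonneg fun _ _ => abs_nonneg _
      linarith
  refine ⟨hmax, fun N => ?_⟩
  have h1 : ∑ j ∈ Finset.range N, |a (j + 1) - a j|
      ≤ ∑ j ∈ Finset.range (J + N), |a (j + 1) - a j| :=
    Finset.sum_le_sum_of_subset_of_nonneg (by simp) fun _ _ _ => abs_nonneg _
  rw [Finset.sum_range_add, hup' J le_rfl, hdown' N] at h1
  linarith [h0 0, h0 (J + N)]

/-- For fixed parity of the time `v`, the function `v ↦ H d v` is unimodal with its peak near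
`v = d ^ 2`. -/
theorem H_unimodal (d : ℤ) (r : ℕ) : ∃ B : ℝ, (1 + |(d : ℝ)|) * B ≤ 3 ∧
    (∀ j, H d (r + 2 * j) ≤ B) ∧
    ∀ N, ∑ j ∈ Finset.range N, |H d (r + 2 * (j + 1)) - H d (r + 2 * j)| ≤ 2 * B := by
  -- the sign of the increment to time `v + 2` is that of `d ^ 2 - (v + 2)`
  have hex : ∃ j : ℕ, d ^ 2 < r + 2 * j + 2 := ⟨(d ^ 2).toNat, by have := sq_nonneg d; omega⟩
  classical
  set J := Nat.find hex with hJ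
  have hJ1 : d ^ 2 < r + 2 * J + 2 := Nat.find_spec hex
  have hJ2 : ∀ j < J, (r : ℤ) + 2 * j + 2 ≤ d ^ 2 := fun j hj => not_lt.1 (Nat.find_min hex hj)
  have key : ∀ j : ℕ, ((r + 2 * j : ℕ) + 1 : ℝ) * ((r + 2 * j : ℕ) + 2)
      * (H d (r + 2 * (j + 1)) - H d (r + 2 * j))
      = (d ^ 2 - (r + 2 * j + 2)) * H d (r + 2 * (j + 1)) := by
    intro j
    have h := H_add_two d (r + 2 * j)
    rw [show r + 2 * j + 2 = r + 2 * (j + 1) by ring] at h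
    push_cast at h ⊢
    linear_combination -h
  have hpos : ∀ j : ℕ, 0 < ((r + 2 * j : ℕ) + 1 : ℝ) * ((r + 2 * j : ℕ) + 2) :=
    fun j => by positivity
  obtain ⟨hmax, hvar⟩ := unimodal_bound (fun j => H d (r + 2 * j)) J (fun j => H_nonneg _ _)
    (by
      intro j hj
      have h1 : ((r : ℝ) + 2 * j + 2) ≤ (d : ℝ) ^ 2 := by exact_mod_cast hJ2 j hj
      have h2 := mul_nonneg (sub_nonneg.2 h1) (H_nonneg d (r + 2 * (j + 1)))
      rw [← key j] at h2
      exact sub_nonneg.1 (nonneg_of_mul_nonneg_right h2 (hpos j)))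
    (by
      intro j hj
      have h1 : (d : ℝ) ^ 2 ≤ ((r : ℝ) + 2 * j + 2) := by
        have : d ^ 2 ≤ (r : ℤ) + 2 * j + 2 := by omega
        exact_mod_cast this
      have h2 := mul_nonneg (sub_nonneg.2 h1) (H_nonneg d (r + 2 * (j + 1)))
      have h3 : 0 ≤ (((r + 2 * j : ℕ) + 1 : ℝ) * ((r + 2 * j : ℕ) + 2))
          * (H d (r + 2 * j) - H d (r + 2 * (j + 1))) := by
        have := key j
        linarith
      exact sub_nonneg.1 (nonneg_of_mul_nonneg_right h3 (hpos j)))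
  refine ⟨H d (r + 2 * J), ?_, hmax, hvar⟩
  have h1 := H_local_bound d (r + 2 * J)
  have h2 : (d : ℝ) ^ 2 ≤ (r + 2 * J : ℕ) + 1 := by
    have : d ^ 2 ≤ (r : ℤ) + 2 * J + 1 := by omega
    exact_mod_cast this
  have h3 : (|(d : ℝ)| * H d (r + 2 * J)) ^ 2 ≤ 2 ^ 2 := by
    rw [mul_pow, sq_abs]
    nlinarith [sq_nonneg (H d (r + 2 * J))]
  have h4 := (pow_le_pow_iff_left₀ (mul_nonneg (abs_nonneg _) (H_nonneg _ _)) (by norm_num)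
    (by norm_num)).1 h3
  linarith [H_le_one d (r + 2 * J)]

/-- For fixed parity of the time `v ≥ 1`, the function `v ↦ H d v / v` is unimodal with its peak
near `v = d ^ 2 / 3`. -/
theorem H_div_unimodal (d : ℤ) (r : ℕ) (hr : 1 ≤ r) : ∃ B : ℝ, |(d : ℝ)| ^ 3 * B ≤ 30 ∧
    (∀ j, H d (r + 2 * j) / (r + 2 * j : ℕ) ≤ B) ∧
    ∀ N, ∑ j ∈ Finset.range N, |H d (r + 2 * (j + 1)) / (r + 2 * (j + 1) : ℕ)
      - H d (r + 2 * j) / (r + 2 * j : ℕ)| ≤ 2 * B := by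
  have hex : ∃ j : ℕ, d ^ 2 < 3 * (r + 2 * j) + 4 :=
    ⟨(d ^ 2).toNat, by have := sq_nonneg d; omega⟩
  classical
  set J := Nat.find hex with hJ
  have hJ1 : d ^ 2 < 3 * (r + 2 * J) + 4 := Nat.find_spec hex
  have hJ2 : ∀ j < J, 3 * ((r : ℤ) + 2 * j) + 4 ≤ d ^ 2 :=
    fun j hj => not_lt.1 (Nat.find_min hex hj)
  have hv : ∀ j : ℕ, (0 : ℝ) < (r + 2 * j : ℕ) := fun j => by
    have : 0 < r + 2 * j := by omega
    exact_mod_cast this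
  -- the sign of the increment from `v` to `v + 2` is that of `d ^ 2 - (3 * v + 4)`
  have key : ∀ j : ℕ, ((r + 2 * j : ℕ) * ((r + 2 * j : ℕ) + 1 : ℝ) * ((r + 2 * j : ℕ) + 2))
      * (H d (r + 2 * (j + 1)) / (r + 2 * (j + 1) : ℕ) - H d (r + 2 * j) / (r + 2 * j : ℕ))
      = (d ^ 2 - (3 * (r + 2 * j) + 4)) * H d (r + 2 * (j + 1)) := by
    intro j
    have h := H_add_two d (r + 2 * j)
    have hv' := hv j
    rw [show r + 2 * j + 2 = r + 2 * (j + 1) by ring] at h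
    rw [show ((r + 2 * (j + 1) : ℕ) : ℝ) = (r + 2 * j : ℕ) + 2 by push_cast; ring]
    have e : ((r : ℝ) + 2 * j) = (r + 2 * j : ℕ) := by push_cast; ring
    rw [e]
    generalize ((r + 2 * j : ℕ) : ℝ) = v at *
    have : v + 2 ≠ 0 := by positivity
    field_simp
    linear_combination -h
  have hpos : ∀ j : ℕ, 0 < (r + 2 * j : ℕ) * ((r + 2 * j : ℕ) + 1 : ℝ) * ((r + 2 * j : ℕ) + 2) :=
    fun j => by have := hv j; positivity
  obtain ⟨hmax, hvar⟩ := unimodal_bound (fun j => H d (r + 2 * j) / (r + 2 * j : ℕ)) J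
    (fun j => div_nonneg (H_nonneg _ _) (hv j).le)
    (by
      intro j hj
      have h1 : (3 * ((r : ℝ) + 2 * j) + 4) ≤ (d : ℝ) ^ 2 := by exact_mod_cast hJ2 j hj
      have h2 := mul_nonneg (sub_nonneg.2 h1) (H_nonneg d (r + 2 * (j + 1)))
      rw [← key j] at h2
      exact sub_nonneg.1 (nonneg_of_mul_nonneg_right h2 (hpos j)))
    (by
      intro j hj
      have h1 : (d : ℝ) ^ 2 ≤ (3 * ((r : ℝ) + 2 * j) + 4) := by
        have : d ^ 2 ≤ 3 * ((r : ℤ) + 2 * j) + 4 := by omega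
        exact_mod_cast this
      have h2 := mul_nonneg (sub_nonneg.2 h1) (H_nonneg d (r + 2 * (j + 1)))
      have h3 : 0 ≤ ((r + 2 * j : ℕ) * ((r + 2 * j : ℕ) + 1 : ℝ) * ((r + 2 * j : ℕ) + 2))
          * (H d (r + 2 * j) / (r + 2 * j : ℕ)
            - H d (r + 2 * (j + 1)) / (r + 2 * (j + 1) : ℕ)) := by
        have := key j
        linarith
      exact sub_nonneg.1 (nonneg_of_mul_nonneg_right h3 (hpos j)))
  refine ⟨_, ?_, hmax, hvar⟩
  have h1 := H_local_bound d (r + 2 * J)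
  have h2 : (d : ℝ) ^ 2 ≤ 6 * (r + 2 * J : ℕ) := by
    have : d ^ 2 ≤ 6 * ((r : ℤ) + 2 * J) := by omega
    exact_mod_cast this
  have h0 := hv J
  generalize ((r + 2 * J : ℕ) : ℝ) = v at *
  generalize H d (r + 2 * J) = h at *
  have h3 : (|(d : ℝ)| ^ 3 * (h / v)) ^ 2 ≤ 30 ^ 2 := by
    have e : (|(d : ℝ)| ^ 3 * (h / v)) ^ 2 = ((d : ℝ) ^ 2) ^ 3 * h ^ 2 / v ^ 2 := by
      rw [mul_pow, div_pow, ← sq_abs (d : ℝ)]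
      ring
    rw [e, div_le_iff₀ (by positivity)]
    calc ((d : ℝ) ^ 2) ^ 3 * h ^ 2 ≤ (6 * v) ^ 3 * h ^ 2 := by gcongr
      _ = 216 * v ^ 2 * (v * h ^ 2) := by ring
      _ ≤ 216 * v ^ 2 * 4 := by
          gcongr
          nlinarith [sq_nonneg h]
      _ ≤ 30 ^ 2 * v ^ 2 := by nlinarith [sq_nonneg v]
  exact (abs_le_of_sq_le_sq' h3 (by norm_num)).2

/-- Summation by parts: a sum with bounded tails of weights against a sequence is bounded by the
first term and the variation of the sequence. -/
theorem abs_sum_sub_mul_le (β a : ℕ → ℝ) (N : ℕ) (hβ : ∀ m, |β m| ≤ 1) (hN : β N = 0) :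
    |∑ m ∈ Finset.range N, (β m - β (m + 1)) * a m|
      ≤ |a 0| + ∑ m ∈ Finset.range N, |a (m + 1) - a m| := by
  have h : ∀ n, ∑ m ∈ Finset.range n, (β m - β (m + 1)) * a m
      = β 0 * a 0 + ∑ m ∈ Finset.range n, β (m + 1) * (a (m + 1) - a m) - β n * a n := by
    intro n
    induction n with
    | zero => simp
    | succ n ih =>
      rw [Finset.sum_range_succ, Finset.sum_range_succ, ih]
      ring
  have hmul : ∀ m x, |β m * x| ≤ |x| := fun m x => by
    rw [abs_mul]
    exact mul_le_of_le_one_left (abs_nonneg _) (hβ m)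
  rw [h, hN, zero_mul, sub_zero]
  refine (abs_add_le _ _).trans (add_le_add (hmul _ _) ?_)
  exact (Finset.abs_sum_le_sum_abs _ _).trans (Finset.sum_le_sum fun m _ => hmul _ _)

/-- Summation by parts in both variables of a function of `m + n`. -/
theorem abs_sum_sum_sub_mul_le (β γ F : ℕ → ℝ) (N : ℕ) (hβ : ∀ m, |β m| ≤ 1) (hβN : β N = 0)
    (hγ : ∀ m, |γ m| ≤ 1) (hγN : γ N = 0) :
    |∑ m ∈ Finset.range N, ∑ n ∈ Finset.range N,
        (β m - β (m + 1)) * (γ n - γ (n + 1)) * F (m + n)|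
      ≤ |F 0| + 2 * ∑ j ∈ Finset.range N, |F (j + 1) - F j|
        + ∑ j ∈ Finset.range (2 * N), (j + 1) * |(F (j + 2) - F (j + 1)) - (F (j + 1) - F j)| := by
  set G : ℕ → ℝ := fun m => ∑ n ∈ Finset.range N, (γ n - γ (n + 1)) * F (m + n) with hG
  set D : ℕ → ℝ := fun j => |(F (j + 2) - F (j + 1)) - (F (j + 1) - F j)| with hD
  have hG0 : |G 0| ≤ |F 0| + ∑ j ∈ Finset.range N, |F (j + 1) - F j| := by
    have := abs_sum_sub_mul_le γ F N hγ hγN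
    simpa [hG] using this
  have hGd : ∀ m, |G (m + 1) - G m|
      ≤ |F (m + 1) - F m| + ∑ n ∈ Finset.range N, D (m + n) := by
    intro m
    have h := abs_sum_sub_mul_le γ (fun n => F (m + n + 1) - F (m + n)) N hγ hγN
    have e : G (m + 1) - G m
        = ∑ n ∈ Finset.range N, (γ n - γ (n + 1)) * (F (m + n + 1) - F (m + n)) := by
      rw [hG, ← Finset.sum_sub_distrib]
      refine Finset.sum_congr rfl fun n _ => ?_
      rw [show m + 1 + n = m + n + 1 by ring]
      ring
    rw [e]
    exact h
  have hsum : ∑ m ∈ Finset.range N, ∑ n ∈ Finset.range N,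
      (β m - β (m + 1)) * (γ n - γ (n + 1)) * F (m + n)
      = ∑ m ∈ Finset.range N, (β m - β (m + 1)) * G m := by
    refine Finset.sum_congr rfl fun m _ => ?_
    rw [hG, Finset.mul_sum]
    exact Finset.sum_congr rfl fun n _ => mul_assoc _ _ _
  -- at most `j + 1` pairs have the sum `j`
  have hconv : ∑ m ∈ Finset.range N, ∑ n ∈ Finset.range N, D (m + n)
      ≤ ∑ j ∈ Finset.range (2 * N), ((j : ℝ) + 1) * D j := by
    rw [← Finset.sum_product']
    rw [← Finset.sum_fiberwise_of_maps_to (t := Finset.range (2 * N)) (g := fun p => p.1 + p.2)]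
    · refine Finset.sum_le_sum fun j _ => ?_
      rw [Finset.sum_congr rfl (g := fun _ => D j) (by
        intro p hp
        rw [(Finset.mem_filter.1 hp).2]), Finset.sum_const, nsmul_eq_mul]
      refine mul_le_mul_of_nonneg_right ?_ (abs_nonneg _)
      have : (Finset.filter (fun p : ℕ × ℕ => p.1 + p.2 = j)
          (Finset.range N ×ˢ Finset.range N)).card ≤ j + 1 := by
        rw [← Finset.Nat.card_antidiagonal j]
        refine Finset.card_le_card fun p hp => ?_
        rw [Finset.HasAntidiagonal.mem_antidiagonal]
        exact (Finset.mem_filter.1 hp).2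
      exact_mod_cast this
    · intro p hp
      simp only [Finset.mem_product, Finset.mem_range] at hp ⊢
      omega
  rw [hsum]
  have h1 := abs_sum_sub_mul_le β G N hβ hβN
  have h2 := Finset.sum_le_sum fun m (_ : m ∈ Finset.range N) => hGd m
  rw [Finset.sum_add_distrib] at h2
  linarith

/-- The weighted second variation in time of `H d` at times of one parity. -/
theorem abs_sum_sum_H_le (β γ : ℕ → ℝ) (N r : ℕ) (d : ℤ) (hβ : ∀ m, |β m| ≤ 1) (hβN : β N = 0)
    (hγ : ∀ m, |γ m| ≤ 1) (hγN : γ N = 0) :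
    |∑ m ∈ Finset.range N, ∑ n ∈ Finset.range N,
        (β m - β (m + 1)) * (γ n - γ (n + 1)) * H d (r + 2 * (m + n))|
      ≤ 200 / (1 + |(d : ℝ)|) := by
  have h := abs_sum_sum_sub_mul_le β γ (fun j => H d (r + 2 * j)) N hβ hβN hγ hγN
  obtain ⟨B, hB, hmax, hvar⟩ := H_unimodal d r
  obtain ⟨B', hB', hmax', hvar'⟩ := H_div_unimodal d (r + 2) (by omega)
  have hB0 : 0 ≤ B := (H_nonneg _ _).trans (hmax 0)
  have hB0' : 0 ≤ B' := le_trans (div_nonneg (H_nonneg _ _) (Nat.cast_nonneg _)) (hmax' 0)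
  have hF : ∀ j : ℕ, ((r + 2 * j : ℕ) + 1 : ℝ) * (H d (r + 2 * (j + 1)) - H d (r + 2 * j))
      = d ^ 2 * (H d (r + 2 + 2 * j) / (r + 2 + 2 * j : ℕ)) - H d (r + 2 * (j + 1)) := by
    intro j
    have h := H_add_two d (r + 2 * j)
    rw [show r + 2 + 2 * j = r + 2 * (j + 1) by ring]
    rw [show r + 2 * j + 2 = r + 2 * (j + 1) by ring] at h
    rw [show ((r + 2 * (j + 1) : ℕ) : ℝ) = (r + 2 * j : ℕ) + 2 by push_cast; ring]
    generalize hv : ((r + 2 * j : ℕ) : ℝ) = v at *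
    have hv0 : 0 ≤ v := by rw [← hv]; positivity
    field_simp
    linear_combination -h
  -- the weight `j + 1` is dominated by the factor `v + 1` that turns increments of `H d`
  -- into differences of two unimodal functions
  have hterm : ∀ j : ℕ, ((j : ℝ) + 1) * |(H d (r + 2 * (j + 2)) - H d (r + 2 * (j + 1)))
        - (H d (r + 2 * (j + 1)) - H d (r + 2 * j))|
      ≤ d ^ 2 * |H d (r + 2 + 2 * (j + 1)) / (r + 2 + 2 * (j + 1) : ℕ)
          - H d (r + 2 + 2 * j) / (r + 2 + 2 * j : ℕ)|
        + 3 * |H d (r + 2 * (j + 1 + 1)) - H d (r + 2 * (j + 1))| := by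
    intro j
    have e : ((r + 2 * j : ℕ) + 1 : ℝ) * ((H d (r + 2 * (j + 2)) - H d (r + 2 * (j + 1)))
        - (H d (r + 2 * (j + 1)) - H d (r + 2 * j)))
        = d ^ 2 * (H d (r + 2 + 2 * (j + 1)) / (r + 2 + 2 * (j + 1) : ℕ)
          - H d (r + 2 + 2 * j) / (r + 2 + 2 * j : ℕ))
        - 3 * (H d (r + 2 * (j + 1 + 1)) - H d (r + 2 * (j + 1))) := by
      have h1 := hF (j + 1)
      have h2 := hF j
      rw [show ((r + 2 * (j + 1) : ℕ) : ℝ) = (r + 2 * j : ℕ) + 2 by push_cast; ring] at h1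
      rw [show j + 2 = j + 1 + 1 by ring]
      linear_combination h1 - h2
    have hle : ((j : ℝ) + 1) ≤ ((r + 2 * j : ℕ) + 1 : ℝ) := by
      have : j + 1 ≤ r + 2 * j + 1 := by omega
      exact_mod_cast this
    refine (mul_le_mul_of_nonneg_right hle (abs_nonneg _)).trans ?_
    have hp : (0 : ℝ) ≤ (r + 2 * j : ℕ) + 1 := by positivity
    have hx : ∀ x : ℝ, ((r + 2 * j : ℕ) + 1 : ℝ) * |x| = |((r + 2 * j : ℕ) + 1 : ℝ) * x| := by
      intro x
      rw [abs_mul, abs_of_nonneg hp]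
    rw [hx, e]
    refine (abs_sub _ _).trans (le_of_eq ?_)
    rw [abs_mul, abs_mul, abs_of_nonneg (sq_nonneg (d : ℝ)), abs_of_nonneg (by norm_num : (0:ℝ) ≤ 3)]
  have h3 := Finset.sum_le_sum fun j (_ : j ∈ Finset.range (2 * N)) => hterm j
  rw [Finset.sum_add_distrib, ← Finset.mul_sum, ← Finset.mul_sum] at h3
  have h4 : ∑ j ∈ Finset.range (2 * N), |H d (r + 2 * (j + 1 + 1)) - H d (r + 2 * (j + 1))|
      ≤ 2 * B := by
    refine le_trans ?_ (hvar (2 * N + 1))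
    rw [Finset.sum_range_succ']
    exact le_add_of_nonneg_right (abs_nonneg _)
  have h5 := mul_le_mul_of_nonneg_left (hvar' (2 * N)) (sq_nonneg (d : ℝ))
  have h6 := hvar N
  have h7 : |H d (r + 2 * 0)| ≤ B := by
    rw [abs_of_nonneg (H_nonneg _ _)]
    exact hmax 0
  have htot : |∑ m ∈ Finset.range N, ∑ n ∈ Finset.range N,
        (β m - β (m + 1)) * (γ n - γ (n + 1)) * H d (r + 2 * (m + n))|
      ≤ 11 * B + 2 * (|(d : ℝ)| ^ 2 * B') := by
    rw [sq_abs]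
    linarith
  refine htot.trans ?_
  rw [le_div_iff₀ (by positivity)]
  -- for integers, `|d| ^ 2 ≤ |d| ^ 3`
  have h8 : |(d : ℝ)| ^ 2 ≤ |(d : ℝ)| ^ 3 := by
    have : |d| ^ 2 ≤ |d| ^ 3 := by
      rcases eq_or_ne d 0 with rfl | hd
      · simp
      · exact pow_le_pow_right₀ (Int.one_le_abs hd) (by norm_num)
    exact_mod_cast this
  have h9 := mul_le_mul_of_nonneg_right h8 hB0'
  nlinarith

/-- The variation in time of the difference of two transition probabilities. -/
theorem abs_sum_H_sub_H_le (β : ℕ → ℝ) (N r : ℕ) (z : ℤ) (hz : z ≠ 0) (hβ : ∀ m, |β m| ≤ 1)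
    (hβN : β N = 0) :
    |∑ m ∈ Finset.range N,
        (β m - β (m + 1)) * (H (z - 1) (r + 2 * m) - H (z + 1) (r + 2 * m))|
      ≤ 180 / (z : ℝ) ^ 2 := by
  obtain ⟨B, hB, hmax, hvar⟩ := H_div_unimodal z (r + 1) (by omega)
  have h := abs_sum_sub_mul_le β (fun j => H z (r + 1 + 2 * j) / (r + 1 + 2 * j : ℕ)) N hβ hβN
  have h0 : |H z (r + 1 + 2 * 0) / (r + 1 + 2 * 0 : ℕ)| ≤ B := by
    rw [abs_of_nonneg (div_nonneg (H_nonneg _ _) (Nat.cast_nonneg _))]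
    exact hmax 0
  have e : ∑ m ∈ Finset.range N,
        (β m - β (m + 1)) * (H (z - 1) (r + 2 * m) - H (z + 1) (r + 2 * m))
      = 2 * z * ∑ m ∈ Finset.range N,
        (β m - β (m + 1)) * (H z (r + 1 + 2 * m) / (r + 1 + 2 * m : ℕ)) := by
    rw [Finset.mul_sum]
    refine Finset.sum_congr rfl fun m _ => ?_
    rw [H_sub_H, show r + 2 * m + 1 = r + 1 + 2 * m by ring]
    ring
  have hz' : 0 < |(z : ℝ)| := by positivity
  rw [e, abs_mul, abs_mul, ← sq_abs (z : ℝ), le_div_iff₀ (by positivity), abs_two]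
  have h1 : |∑ m ∈ Finset.range N,
        (β m - β (m + 1)) * (H z (r + 1 + 2 * m) / (r + 1 + 2 * m : ℕ))| ≤ 3 * B := by
    linarith [hvar N]
  calc _ ≤ 2 * |(z : ℝ)| * (3 * B) * |(z : ℝ)| ^ 2 := by gcongr
    _ = 6 * (|(z : ℝ)| ^ 3 * B) := by ring
    _ ≤ 180 := by linarith

/-! ### The discrepancy as a sum over the turns of the arrows -/

/-- Half the decrease of the arrow at `y` in the step from time `s` to `s + 1`: the arrow itself if
the number of chips there is odd, and zero otherwise. -/
noncomputable def Config.turn (c : Config) (y : ℤ) (s : ℕ) : ℝ :=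
  ((((c.run s).arr y : ℤ) : ℝ) - (((c.run (s + 1)).arr y : ℤ) : ℝ)) / 2

/-- The sum over the vertices of `S` and the times before `t` of the turns of arrows, each spread by
a random walk until time `t - 1`. -/
noncomputable def Config.potential (c : Config) (S : Finset ℤ) (t : ℕ) (b : ℤ) : ℝ :=
  ∑ y ∈ S, ∑ s ∈ Finset.range t, c.turn y s * H (b - y) (t - 1 - s)

theorem Config.run_succ_arr (c : Config) (y : ℤ) (s : ℕ) :
    (c.run (s + 1)).arr y = (-1) ^ (c.run s).chips y * (c.run s).arr y := rfl

theorem Config.turn_eq (c : Config) (y : ℤ) (s : ℕ) :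
    c.turn y s = (((c.run s).arr y : ℤ) : ℝ) * (((c.run s).chips y % 2 : ℕ) : ℝ) := by
  unfold Config.turn
  rw [Config.run_succ_arr]
  rcases Nat.even_or_odd ((c.run s).chips y) with h | h
  · rw [h.neg_one_pow, Nat.even_iff.1 h]
    simp
  · rw [h.neg_one_pow, Nat.odd_iff.1 h]
    push_cast
    ring

theorem Config.run_sub_E (c : Config) (S : Finset ℤ) (t : ℕ) (x : ℤ)
    (hS : Finset.Icc (x - t) (x + t) ⊆ S) :
    ((c.run t).chips x : ℝ) - c.E x t
      = (c.potential S t (x - 1) - c.potential S t (x + 1)) / 2 := by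
  induction t generalizing x with
  | zero => simp [Config.potential, Config.E_zero, Config.run]
  | succ t ih =>
    have hl : x - 1 ∈ S := hS (by rw [Finset.mem_Icc]; push_cast; omega)
    have hr : x + 1 ∈ S := hS (by rw [Finset.mem_Icc]; push_cast; omega)
    have h1 := ih (x - 1) ((Finset.Icc_subset_Icc (by push_cast; omega)
      (by push_cast; omega)).trans hS)
    have h2 := ih (x + 1) ((Finset.Icc_subset_Icc (by push_cast; omega)
      (by push_cast; omega)).trans hS)
    have hpot : ∀ b ∈ S, c.potential S (t + 1) b
        = (c.potential S t (b - 1) + c.potential S t (b + 1)) / 2 + c.turn b t := by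
      intro b hb
      unfold Config.potential
      have e : ∀ y, ∑ s ∈ Finset.range (t + 1), c.turn y s * H (b - y) (t + 1 - 1 - s)
          = (∑ s ∈ Finset.range t, c.turn y s * H (b - 1 - y) (t - 1 - s)
            + ∑ s ∈ Finset.range t, c.turn y s * H (b + 1 - y) (t - 1 - s)) / 2
            + if b = y then c.turn y t else 0 := by
        intro y
        rw [Finset.sum_range_succ, ← Finset.sum_add_distrib, Finset.sum_div]
        congr 1
        · refine Finset.sum_congr rfl fun s hs => ?_
          rw [Finset.mem_range] at hs
          rw [show t + 1 - 1 - s = t - 1 - s + 1 by omega, H_succ,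
            show b - y - 1 = b - 1 - y by ring, show b - y + 1 = b + 1 - y by ring]
          ring
        · simp [H_zero, sub_eq_zero]
      rw [Finset.sum_congr rfl fun y _ => e y, Finset.sum_add_distrib, ← Finset.sum_div,
        Finset.sum_add_distrib, Finset.sum_ite_eq, if_pos hb]
    have h3 := c.run t |>.step_chips x
    rw [mul_div_assoc, mul_div_assoc, ← mul_div_assoc, ← mul_div_assoc, ← Config.turn_eq,
      ← Config.turn_eq] at h3
    rw [Config.E_succ, hpot _ hl, hpot _ hr, show c.run (t + 1) = (c.run t).step from rfl, h3]
    rw [show x - 1 - 1 = x - 2 by ring, show x - 1 + 1 = x by ring] at *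
    rw [show x + 1 - 1 = x by ring, show x + 1 + 1 = x + 2 by ring] at *
    linarith

theorem sum_interval (f : ℤ → ℝ) (b : ℤ) (L : ℕ) :
    ∑ x ∈ interval b L, f x = ∑ i ∈ Finset.range L, f (b + i) := by
  symm
  refine Finset.sum_bij (fun i _ => b + (i : ℤ)) ?_ ?_ ?_ ?_
  · intro i hi
    rw [Finset.mem_range] at hi
    rw [interval, Finset.mem_Icc]
    omega
  · intro i _ j _ h
    omega
  · intro x hx
    rw [interval, Finset.mem_Icc] at hx
    exact ⟨(x - b).toNat, by rw [Finset.mem_range]; omega, by omega⟩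
  · intro i _
    rfl

theorem translate_interval (a k : ℤ) (L : ℕ) :
    translate (interval a L) k = interval (a + k) L := by
  ext x
  simp only [translate, interval, Finset.mem_image, Finset.mem_Icc]
  constructor
  · rintro ⟨z, hz, rfl⟩
    omega
  · intro hx
    exact ⟨x - k, by omega, by omega⟩

theorem sum_interval_sub (g : ℤ → ℝ) (b : ℤ) (L : ℕ) :
    ∑ x ∈ interval b L, (g (x - 1) - g (x + 1)) = g (b - 1) + g b - g (b + L - 1) - g (b + L) := by
  rw [sum_interval]
  induction L with
  | zero => simp
  | succ L ih =>
    rw [Finset.sum_range_succ, ih, show b + (L + 1 : ℕ) - 1 = b + L by push_cast; ring,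
      show b + (L + 1 : ℕ) = b + L + 1 by push_cast; ring]
    ring

theorem Config.disc_interval (c : Config) (S : Finset ℤ) (t : ℕ) (b : ℤ) (L : ℕ)
    (hS : Finset.Icc (b - t) (b + L + t) ⊆ S) :
    c.disc (interval b L) t
      = (∑ x ∈ interval b L, (c.potential S t (x - 1) - c.potential S t (x + 1))) / 2 := by
  rw [Config.disc, ← Finset.sum_sub_distrib, Finset.sum_div]
  refine Finset.sum_congr rfl fun x hx => c.run_sub_E S t x ?_
  rw [interval, Finset.mem_Icc] at hx
  exact (Finset.Icc_subset_Icc (by omega) (by omega)).trans hS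

/-- The chips of a configuration that lives on one parity class change the class in each step. -/
theorem Config.run_chips_eq_zero (c : Config) (p : ℤ) (hc : ∀ x, Odd (x + p) → c.chips x = 0)
    (s : ℕ) (y : ℤ) (hy : Odd (y + s + p)) : (c.run s).chips y = 0 := by
  induction s generalizing y with
  | zero => exact hc y (by simpa using hy)
  | succ s ih =>
    rw [Int.odd_iff] at hy
    push_cast at hy
    have h1 := ih (y - 1) (by rw [Int.odd_iff]; omega)
    have h2 := ih (y + 1) (by rw [Int.odd_iff]; omega)
    change (c.run s).sentRight (y - 1) + (c.run s).sentLeft (y + 1) = 0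
    simp [Config.sentRight, Config.sentLeft, h1, h2]

theorem sum_range_of_parity (ψ : ℕ → ℝ) (r N : ℕ) (hr : r ≤ 1)
    (hψ : ∀ u, u % 2 ≠ r → ψ u = 0) :
    ∑ u ∈ Finset.range (r + 2 * N), ψ u = ∑ m ∈ Finset.range N, ψ (r + 2 * m) := by
  induction N with
  | zero =>
    interval_cases r
    · simp
    · simpa using hψ 0 (by norm_num)
  | succ N ih =>
    rw [show r + 2 * (N + 1) = r + 2 * N + 1 + 1 by ring, Finset.sum_range_succ,
      Finset.sum_range_succ, Finset.sum_range_succ, ih, hψ (r + 2 * N + 1) (by omega), add_zero]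

/-- The turns of one arrow happen at times of one parity. In terms of the remaining time `u`, which
then is `r + 2 * m`, they are the decrements of a bounded sequence. -/
theorem Config.exists_turn_eq (c : Config) (p : ℤ) (hc : ∀ x, Odd (x + p) → c.chips x = 0)
    (t : ℕ) (y : ℤ) :
    ∃ (r : ℕ) (β : ℕ → ℝ), r ≤ 1 ∧ (∀ m, |β m| ≤ 1) ∧ β t = 0 ∧ ∀ φ : ℕ → ℝ,
      ∑ s ∈ Finset.range t, c.turn y s * φ (t - 1 - s)
        = ∑ m ∈ Finset.range t, (β m - β (m + 1)) * φ (r + 2 * m) := by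
  set B : ℕ → ℝ := fun u => (((c.run (t - u)).arr y : ℤ) : ℝ) with hB
  have hB1 : ∀ u, |B u| ≤ 1 := by
    intro u
    rcases Int.units_eq_one_or ((c.run (t - u)).arr y) with h | h <;> simp [hB, h]
  set r : ℕ := ((y + t - 1 + p) % 2).toNat with hr
  have hBr : ∀ u, u % 2 ≠ r → B (u + 1) = B u := by
    intro u hu
    rcases Nat.lt_or_ge u t with h | h
    · have h0 : (c.run (t - (u + 1))).chips y = 0 := by
        refine c.run_chips_eq_zero p hc _ _ ?_
        rw [Int.odd_iff]
        omega
      have h1 := c.run_succ_arr y (t - (u + 1))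
      rw [h0, pow_zero, one_mul, show t - (u + 1) + 1 = t - u by omega] at h1
      simp only [hB, h1]
    · simp only [hB, show t - (u + 1) = t - u by omega]
  have hBt : ∀ u, t ≤ u → B u = B t := by
    intro u hu
    simp only [hB, show t - u = t - t by omega]
  refine ⟨r, fun m => (B t - B (r + 2 * m)) / 2, by omega, ?_, ?_, ?_⟩
  · intro m
    have h1 := abs_le.1 (hB1 t)
    have h2 := abs_le.1 (hB1 (r + 2 * m))
    rw [abs_le]
    constructor <;> linarith
  · simp only [hBt (r + 2 * t) (by omega), sub_self, zero_div]
  · intro φ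
    set ψ : ℕ → ℝ := fun u => (B (u + 1) - B u) / 2 * φ u with hψ
    have h1 : ∑ s ∈ Finset.range t, c.turn y s * φ (t - 1 - s) = ∑ u ∈ Finset.range t, ψ u := by
      rw [← Finset.sum_range_reflect]
      refine Finset.sum_congr rfl fun u hu => ?_
      rw [Finset.mem_range] at hu
      simp only [hψ, hB, Config.turn]
      rw [show t - 1 - (t - 1 - u) = u by omega, show t - 1 - u + 1 = t - u by omega,
        show t - 1 - u = t - (u + 1) by omega]
    have h2 : ∑ u ∈ Finset.range t, ψ u = ∑ u ∈ Finset.range (r + 2 * t), ψ u := by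
      refine Finset.sum_subset (by rw [Finset.range_subset_range]; omega) fun u _ hu => ?_
      rw [Finset.mem_range, not_lt] at hu
      simp only [hψ, hBt u hu, hBt (u + 1) (by omega), sub_self, zero_div, zero_mul]
    have h3 : ∀ u, u % 2 ≠ r → ψ u = 0 := by
      intro u hu
      simp only [hψ, hBr u hu, sub_self, zero_div, zero_mul]
    rw [h1, h2, sum_range_of_parity ψ r t (by omega) h3]
    refine Finset.sum_congr rfl fun m _ => ?_
    have h4 := hBr (r + 2 * m + 1) (by omega)
    rw [show r + 2 * m + 1 + 1 = r + 2 * (m + 1) by ring] at h4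
    simp only [hψ, h4]
    ring

/-! ### The upper bound -/

theorem sum_natAbs_le (S : Finset ℤ) (x : ℤ) (D : Finset ℕ) (w : ℕ → ℝ) (hw : ∀ d, 0 ≤ w d)
    (hD : ∀ y ∈ S, (x - y).natAbs ∈ D) :
    ∑ y ∈ S, w (x - y).natAbs ≤ 2 * ∑ d ∈ D, w d := by
  rw [← Finset.sum_fiberwise_of_maps_to hD, Finset.mul_sum]
  refine Finset.sum_le_sum fun d _ => ?_
  rw [Finset.sum_congr rfl (g := fun _ => w d) (by
    intro y hy
    rw [(Finset.mem_filter.1 hy).2]), Finset.sum_const, nsmul_eq_mul]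
  refine mul_le_mul_of_nonneg_right ?_ (hw d)
  have h : (Finset.filter (fun y => (x - y).natAbs = d) S) ⊆ {x - d, x + d} := by
    intro y hy
    have := (Finset.mem_filter.1 hy).2
    simp only [Finset.mem_insert, Finset.mem_singleton]
    omega
  exact_mod_cast (Finset.card_le_card h).trans Finset.card_le_two

theorem Config.potential_filter_add (c : Config) (S : Finset ℤ) (t : ℕ) (b : ℤ) (q : ℤ → Prop)
    [DecidablePred q] :
    c.potential S t b
      = c.potential (S.filter q) t b + c.potential (S.filter fun y => ¬ q y) t b :=
  (Finset.sum_filter_add_sum_filter_not _ _ _).symm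

/-- The vertices far from `x` contribute little to the discrepancy at `x`. -/
theorem Config.abs_potential_sub_le (c : Config) (p : ℤ) (hc : ∀ x, Odd (x + p) → c.chips x = 0)
    (Y : Finset ℤ) (t : ℕ) (x : ℤ) (hY : x ∉ Y) :
    |c.potential Y t (x - 1) - c.potential Y t (x + 1)| ≤ ∑ y ∈ Y, 180 / ((x - y : ℤ) : ℝ) ^ 2 := by
  unfold Config.potential
  rw [← Finset.sum_sub_distrib]
  refine (Finset.abs_sum_le_sum_abs _ _).trans (Finset.sum_le_sum fun y hy => ?_)
  obtain ⟨r, β, -, hβ, hβt, h⟩ := c.exists_turn_eq p hc t y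
  rw [h fun u => H (x - 1 - y) u, h fun u => H (x + 1 - y) u, ← Finset.sum_sub_distrib]
  have hne : x - y ≠ 0 := by
    rintro h0
    rw [sub_eq_zero.1 h0] at hY
    exact hY hy
  refine le_trans (le_of_eq ?_) (abs_sum_H_sub_H_le β t r (x - y) hne hβ hβt)
  congr 1
  refine Finset.sum_congr rfl fun m _ => ?_
  rw [show x - 1 - y = x - y - 1 by ring, show x + 1 - y = x - y + 1 by ring]
  ring

/-- The sum over all places of the squared potential of the vertices of `Y`. The pairs of vertices
at distance `d` contribute at most of the order of `1 / (1 + d)`. -/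
theorem Config.sum_potential_sq_le (c : Config) (p : ℤ)
    (hc : ∀ x, Odd (x + p) → c.chips x = 0) (Y Z : Finset ℤ) (t : ℕ)
    (hZ : ∀ y ∈ Y, Finset.Icc (y - (2 * t + 1)) (y + (2 * t + 1)) ⊆ Z) :
    ∑ b ∈ Z, c.potential Y t b ^ 2
      ≤ ∑ y ∈ Y, ∑ y' ∈ Y, 200 / (1 + |((y - y' : ℤ) : ℝ)|) := by
  choose r β hr hβ hβt h using c.exists_turn_eq p hc t
  have hpot : ∀ b, c.potential Y t b
      = ∑ y ∈ Y, ∑ m ∈ Finset.range t, (β y m - β y (m + 1)) * H (b - y) (r y + 2 * m) := by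
    intro b
    exact Finset.sum_congr rfl fun y _ => h y fun u => H (b - y) u
  have hsq : ∀ b, c.potential Y t b ^ 2 = ∑ y ∈ Y, ∑ y' ∈ Y, ∑ m ∈ Finset.range t,
      ∑ n ∈ Finset.range t, (β y m - β y (m + 1)) * (β y' n - β y' (n + 1))
        * (H (b - y') (r y' + 2 * n) * H (b - y) (r y + 2 * m)) := by
    intro b
    rw [hpot, sq, Finset.sum_mul_sum]
    refine Finset.sum_congr rfl fun y _ => Finset.sum_congr rfl fun y' _ => ?_
    rw [Finset.sum_mul_sum]
    refine Finset.sum_congr rfl fun m _ => Finset.sum_congr rfl fun n _ => ?_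
    ring
  have htotal : ∑ b ∈ Z, c.potential Y t b ^ 2 = ∑ y ∈ Y, ∑ y' ∈ Y, ∑ m ∈ Finset.range t,
      ∑ n ∈ Finset.range t, (β y m - β y (m + 1)) * (β y' n - β y' (n + 1))
        * H (y - y') (r y + r y' + 2 * (m + n)) := by
    rw [Finset.sum_congr rfl fun b _ => hsq b, Finset.sum_comm]
    refine Finset.sum_congr rfl fun y hy => ?_
    rw [Finset.sum_comm]
    refine Finset.sum_congr rfl fun y' _ => ?_
    rw [Finset.sum_comm]
    refine Finset.sum_congr rfl fun m hm => ?_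
    rw [Finset.sum_comm]
    refine Finset.sum_congr rfl fun n _ => ?_
    rw [Finset.mem_range] at hm
    have hry := hr y
    rw [← Finset.mul_sum, sum_H_mul_H Z y y',
      show r y + 2 * m + (r y' + 2 * n) = r y + r y' + 2 * (m + n) by ring]
    exact (Finset.Icc_subset_Icc (by push_cast; omega) (by push_cast; omega)).trans (hZ y hy)
  rw [htotal]
  refine Finset.sum_le_sum fun y _ => Finset.sum_le_sum fun y' _ => ?_
  exact (le_abs_self _).trans
    (abs_sum_sum_H_le (β y) (β y') t _ (y - y') (hβ y) (hβt y) (hβ y') (hβt y'))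

theorem sum_inv_one_add_abs_le (Y : Finset ℤ) (lo : ℤ) (n : ℕ) (hn : 1 ≤ n)
    (hY : Y ⊆ Finset.Ico lo (lo + n)) :
    ∑ y ∈ Y, ∑ y' ∈ Y, 200 / (1 + |((y - y' : ℤ) : ℝ)|) ≤ 400 * n * (1 + Real.log n) := by
  have hrow : ∀ y ∈ Y, ∑ y' ∈ Y, 200 / (1 + |((y - y' : ℤ) : ℝ)|) ≤ 400 * (1 + Real.log n) := by
    intro y hy
    have h1 := sum_natAbs_le Y y (Finset.range n) (fun d => 200 / (1 + (d : ℝ)))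
      (fun d => by positivity) (by
        intro y' hy'
        have h1 := Finset.mem_Ico.1 (hY hy)
        have h2 := Finset.mem_Ico.1 (hY hy')
        rw [Finset.mem_range]
        omega)
    have h2 := harmonic_le_one_add_log n
    have h3 : ∑ d ∈ Finset.range n, 200 / (1 + (d : ℝ)) = 200 * (harmonic n : ℝ) := by
      rw [harmonic]
      push_cast
      rw [Finset.mul_sum]
      refine Finset.sum_congr rfl fun d _ => ?_
      rw [div_eq_mul_inv, add_comm]
    rw [h3] at h1
    refine le_trans (le_of_eq ?_) (h1.trans (by linarith))
    refine Finset.sum_congr rfl fun y' _ => ?_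
    rw [Nat.cast_natAbs]
    push_cast
    rfl
  refine (Finset.sum_le_sum hrow).trans ?_
  rw [Finset.sum_const, nsmul_eq_mul]
  have hcard : (Y.card : ℝ) ≤ n := by
    have := Finset.card_le_card hY
    rw [Int.card_Ico] at this
    exact_mod_cast this.trans (by omega)
  have hlog : 0 ≤ Real.log n := Real.log_natCast_nonneg n
  nlinarith

theorem sum_far_inv_sq_le (Y : Finset ℤ) (x : ℤ) (L : ℕ) (hL : 1 ≤ L)
    (hY : ∀ y ∈ Y, L < (x - y).natAbs) :
    ∑ y ∈ Y, 180 / ((x - y : ℤ) : ℝ) ^ 2 ≤ 360 / (L : ℝ) := by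
  set n : ℕ := max L (Y.sup fun y => (x - y).natAbs) with hn
  have h1 := sum_natAbs_le Y x (Finset.Ioc L n) (fun d => 180 * ((d : ℝ) ^ 2)⁻¹)
    (fun d => by positivity) (by
      intro y hy
      rw [Finset.mem_Ioc]
      exact ⟨hY y hy, le_max_of_le_right (Finset.le_sup (f := fun y => (x - y).natAbs) hy)⟩)
  have h2 := sum_Ioc_inv_sq_le_sub (α := ℝ) (k := L) (n := n) (by omega) (le_max_left _ _)
  rw [← Finset.mul_sum, ← Finset.mul_sum] at h1
  have h3 : (0 : ℝ) ≤ (n : ℝ)⁻¹ := by positivity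
  have h4 : ∑ y ∈ Y, 180 / ((x - y : ℤ) : ℝ) ^ 2
      = ∑ y ∈ Y, 180 * ((((x - y).natAbs : ℕ) : ℝ) ^ 2)⁻¹ := by
    refine Finset.sum_congr rfl fun y _ => ?_
    rw [Nat.cast_natAbs, div_eq_mul_inv]
    push_cast
    rw [sq_abs]
  rw [h4, ← Finset.mul_sum, div_eq_mul_inv]
  linarith

/-- The upper bound for the `L` translates of an interval of length `L` by `0, …, L - 1`. -/
theorem Config.sum_disc_sq_block_le (c : Config) (p : ℤ)
    (hc : ∀ x, Odd (x + p) → c.chips x = 0) (t : ℕ) (b : ℤ) (L : ℕ) (hL : 2 ≤ L) :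
    ∑ k ∈ Finset.range L, c.disc (interval (b + k) L) t ^ 2 ≤ 300000 * L * Real.log L := by
  set S : Finset ℤ := Finset.Icc (b - (4 * t + 8 * L + 8)) (b + (4 * t + 8 * L + 8)) with hS
  set near : ℤ → Prop := fun y => b - L ≤ y ∧ y < b + 3 * L with hnear
  set Y := S.filter near with hY
  set Y' := S.filter fun y => ¬ near y with hY'
  have hL0 : (2 : ℝ) ≤ L := by exact_mod_cast hL
  have hLpos : (0 : ℝ) < L := by linarith
  -- the vertices outside of the neighbourhood of the block contribute `O(1)` for each translate
  have hfar : ∀ k ∈ Finset.range L, |∑ x ∈ interval (b + k) L,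
      (c.potential Y' t (x - 1) - c.potential Y' t (x + 1))| ≤ 360 := by
    intro k hk
    rw [Finset.mem_range] at hk
    have h1 : ∀ x ∈ interval (b + k) L,
        |c.potential Y' t (x - 1) - c.potential Y' t (x + 1)| ≤ 360 / L := by
      intro x hx
      rw [interval, Finset.mem_Icc] at hx
      have hdist : ∀ y ∈ Y', L < (x - y).natAbs := by
        intro y hy
        have := (Finset.mem_filter.1 hy).2
        simp only [hnear] at this
        omega
      refine (c.abs_potential_sub_le p hc Y' t x ?_).trans
        (sum_far_inv_sq_le Y' x L (by omega) hdist)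
      intro hx'
      have := hdist x hx'
      simp at this
    refine (Finset.abs_sum_le_sum_abs _ _).trans ((Finset.sum_le_sum h1).trans (le_of_eq ?_))
    rw [sum_interval, Finset.sum_const, Finset.card_range, nsmul_eq_mul]
    field_simp
  have hdisc : ∀ k ∈ Finset.range L, c.disc (interval (b + k) L) t ^ 2
      ≤ 2 * (c.potential Y t (b + k - 1) ^ 2 + c.potential Y t (b + k) ^ 2
        + c.potential Y t (b + k + L - 1) ^ 2 + c.potential Y t (b + k + L) ^ 2)
        + 64800 := by
    intro k hk
    have h1 := abs_le.1 (hfar k hk)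
    rw [Finset.mem_range] at hk
    have h2 := c.disc_interval S t (b + k) L (by
      refine Finset.Icc_subset_Icc ?_ ?_ <;> omega)
    have h3 : ∑ x ∈ interval (b + k) L, (c.potential S t (x - 1) - c.potential S t (x + 1))
        = ∑ x ∈ interval (b + k) L, (c.potential Y t (x - 1) - c.potential Y t (x + 1))
          + ∑ x ∈ interval (b + k) L, (c.potential Y' t (x - 1) - c.potential Y' t (x + 1)) := by
      rw [← Finset.sum_add_distrib]
      refine Finset.sum_congr rfl fun x _ => ?_
      rw [c.potential_filter_add S t (x - 1) near, c.potential_filter_add S t (x + 1) near]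
      ring
    rw [h2, h3, sum_interval_sub]
    generalize ∑ x ∈ interval (b + k) L, (c.potential Y' t (x - 1) - c.potential Y' t (x + 1)) = e
      at *
    generalize c.potential Y t (b + k - 1) = p1
    generalize c.potential Y t (b + k) = p2
    generalize c.potential Y t (b + k + L - 1) = p3
    generalize c.potential Y t (b + k + L) = p4
    have he : e ^ 2 ≤ 360 ^ 2 := by nlinarith
    nlinarith [sq_nonneg (p1 - p2), sq_nonneg (p1 + p3), sq_nonneg (p1 + p4), sq_nonneg (p2 + p3),
      sq_nonneg (p2 + p4), sq_nonneg (p3 - p4), sq_nonneg (p1 + p2 - p3 - p4 - e)]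
  have henergy : ∑ z ∈ S, c.potential Y t z ^ 2 ≤ 400 * (4 * L) * (1 + Real.log (4 * L)) := by
    have h1 := c.sum_potential_sq_le p hc Y S t (by
      intro y hy
      have := (Finset.mem_filter.1 hy).2
      simp only [hnear] at this
      refine Finset.Icc_subset_Icc ?_ ?_ <;> omega)
    have h2 := sum_inv_one_add_abs_le Y (b - L) (4 * L) (by omega) (by
      intro y hy
      have := (Finset.mem_filter.1 hy).2
      simp only [hnear] at this
      rw [Finset.mem_Ico]
      push_cast
      omega)
    rw [Nat.cast_mul, Nat.cast_ofNat] at h2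
    exact h1.trans h2
  have hshift : ∀ s : ℤ, -1 ≤ s → s ≤ L → ∑ k ∈ Finset.range L, c.potential Y t (b + k + s) ^ 2
      ≤ ∑ z ∈ S, c.potential Y t z ^ 2 := by
    intro s hs1 hs2
    rw [← Finset.sum_image (s := Finset.range L) (g := fun k : ℕ => b + (k : ℤ) + s)
      (f := fun z => c.potential Y t z ^ 2)]
    · refine Finset.sum_le_sum_of_subset_of_nonneg ?_ fun _ _ _ => sq_nonneg _
      intro z hz
      obtain ⟨k, hk, rfl⟩ := Finset.mem_image.1 hz
      rw [Finset.mem_range] at hk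
      rw [hS, Finset.mem_Icc]
      omega
    · intro i _ j _ h
      simp only at h
      omega
  have hlog4 : Real.log (4 * L) ≤ 3 * Real.log L := by
    have : Real.log ((L : ℝ) ^ 3) = 3 * Real.log L := by
      rw [Real.log_pow]
      norm_num
    rw [← this]
    refine Real.log_le_log (by positivity) ?_
    nlinarith [sq_nonneg (L : ℝ)]
  have hlog1 : 1 ≤ 2 * Real.log L := by
    have := Real.log_le_log (by norm_num) hL0
    linarith [Real.log_two_gt_d9]
  refine (Finset.sum_le_sum hdisc).trans ?_
  rw [Finset.sum_add_distrib, ← Finset.mul_sum, Finset.sum_add_distrib, Finset.sum_add_distrib,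
    Finset.sum_add_distrib, Finset.sum_const, Finset.card_range, nsmul_eq_mul]
  have s1 := hshift (-1) (by omega) (by omega)
  have s2 := hshift 0 (by omega) (by omega)
  have s3 := hshift (L - 1) (by omega) (by omega)
  have s4 := hshift L (by omega) (by omega)
  simp only [add_zero, ← sub_eq_add_neg, ← add_sub_assoc] at s1 s2 s3 s4
  have hfin : 400 * (4 * L) * (1 + Real.log (4 * L)) ≤ 8000 * (L * Real.log L) := by
    nlinarith
  have hone : (L : ℝ) * 64800 ≤ 129600 * (L * Real.log L) := by nlinarith
  have hnn : 0 ≤ (L : ℝ) * Real.log L := by nlinarith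
  linarith

theorem sum_Icc_one (f : ℕ → ℝ) (M : ℕ) :
    ∑ k ∈ Finset.Icc 1 M, f k = ∑ k ∈ Finset.range M, f (k + 1) := by
  rw [Finset.range_eq_Ico, Finset.sum_Ico_add' f 0 M 1]
  rfl

/-- The upper bound for the mean squared discrepancy; the translates are cut into blocks of `L`. -/
theorem Config.meanSqDisc_le (c : Config) (hc : c.IsEven ∨ c.IsOdd) (t : ℕ) (a : ℤ) (L M : ℕ)
    (hL : 2 ≤ L) (hM : L ≤ M) :
    c.meanSqDisc (interval a L) M t ≤ 600000 * Real.log L := by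
  obtain ⟨p, hp⟩ : ∃ p : ℤ, ∀ x, Odd (x + p) → c.chips x = 0 := by
    rcases hc with h | h
    · exact ⟨0, fun x hx => h x (by simpa using hx)⟩
    · refine ⟨1, fun x hx => h x ?_⟩
      rw [Int.odd_iff] at hx
      rw [Int.even_iff]
      omega
  set g : ℕ → ℝ := fun k => c.disc (interval (a + 1 + k) L) t ^ 2 with hg
  have hblocks : ∀ q : ℕ, ∑ k ∈ Finset.range (L * q), g k
      ≤ q * (300000 * L * Real.log L) := by
    intro q
    induction q with
    | zero => simp
    | succ q ih =>
      have h := c.sum_disc_sq_block_le p hp t (a + 1 + (L * q : ℕ)) L hL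
      rw [Nat.mul_succ, Finset.sum_range_add]
      have e : ∑ k ∈ Finset.range L, g (L * q + k)
          = ∑ k ∈ Finset.range L, c.disc (interval (a + 1 + (L * q : ℕ) + k) L) t ^ 2 := by
        refine Finset.sum_congr rfl fun k _ => ?_
        simp only [hg]
        rw [Nat.cast_add (L * q) k, ← add_assoc]
      rw [e]
      push_cast at h ⊢
      linarith
  have hsum : ∑ k ∈ Finset.Icc (1 : ℕ) M, c.disc (translate (interval a L) (k : ℤ)) t ^ 2
      = ∑ k ∈ Finset.range M, g k := by
    rw [sum_Icc_one fun k : ℕ => c.disc (translate (interval a L) (k : ℤ)) t ^ 2]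
    refine Finset.sum_congr rfl fun k _ => ?_
    simp only [hg]
    rw [translate_interval, Nat.cast_succ, show a + ((k : ℤ) + 1) = a + 1 + k by ring]
  have hM0 : (0 : ℝ) < M := by
    have : 0 < M := by omega
    exact_mod_cast this
  have hlog : 0 ≤ Real.log L := Real.log_natCast_nonneg L
  have hq : ((M / L + 1 : ℕ) : ℝ) * L ≤ 2 * M := by
    have h1 : M / L * L ≤ M := Nat.div_mul_le_self M L
    have h2 : (M / L + 1) * L ≤ 2 * M := by
      rw [Nat.succ_mul]
      omega
    exact_mod_cast h2
  have hle : ∑ k ∈ Finset.range M, g k ≤ ∑ k ∈ Finset.range (L * (M / L + 1)), g k := by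
    refine Finset.sum_le_sum_of_subset_of_nonneg ?_ fun _ _ _ => sq_nonneg _
    rw [Finset.range_subset_range]
    exact (Nat.lt_mul_div_succ M (by omega)).le
  rw [Config.meanSqDisc, hsum, one_div, inv_mul_le_iff₀ hM0]
  have h1 := hblocks (M / L + 1)
  have h2 := mul_le_mul_of_nonneg_right hq hlog
  linarith

/-! ### Forcing the arrows -/

/-- The number of paths of `s` steps `1` or `-1` from the origin to `z`. -/
def pathCount : ℕ → ℤ → ℕ
  | 0, z => if z = 0 then 1 else 0
  | s + 1, z => pathCount s (z - 1) + pathCount s (z + 1)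

theorem pathCount_eq_zero (s : ℕ) (z : ℤ) (h : z < -s) : pathCount s z = 0 := by
  induction s generalizing z with
  | zero => exact if_neg (by simp at h; omega)
  | succ s ih =>
    rw [pathCount, ih _ (by push_cast at h; omega), ih _ (by push_cast at h; omega)]

theorem pathCount_neg (s : ℕ) : pathCount s (-s) = 1 := by
  induction s with
  | zero => simp [pathCount]
  | succ s ih =>
    rw [pathCount, pathCount_eq_zero s _ (by push_cast; omega),
      show -((s + 1 : ℕ) : ℤ) + 1 = -s by push_cast; ring, ih]

/-- A pile of `2 ^ T` additional chips is split evenly until time `T`, and so does not affect the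
arrows until then. -/
theorem Config.run_add_pile (c c' : Config) (x₀ : ℤ) (T : ℕ)
    (hchips : ∀ x, c'.chips x = c.chips x + 2 ^ T * pathCount 0 (x - x₀)) (harr : c'.arr = c.arr)
    (s : ℕ) (hs : s ≤ T) (x : ℤ) :
    (c'.run s).chips x = (c.run s).chips x + 2 ^ (T - s) * pathCount s (x - x₀)
      ∧ (c'.run s).arr x = (c.run s).arr x := by
  induction s generalizing x with
  | zero => exact ⟨hchips x, by rw [Config.run, Config.run, harr]⟩
  | succ s ih =>
    have hpow : 2 ^ (T - s) = 2 * 2 ^ (T - (s + 1)) := by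
      rw [← pow_succ', show T - (s + 1) + 1 = T - s by omega]
    have hstep : ∀ y, (c'.run s).sentRight y
          = (c.run s).sentRight y + 2 ^ (T - (s + 1)) * pathCount s (y - x₀)
        ∧ (c'.run s).sentLeft y
          = (c.run s).sentLeft y + 2 ^ (T - (s + 1)) * pathCount s (y - x₀) := by
      intro y
      obtain ⟨h1, h2⟩ := ih (by omega) y
      rw [hpow, mul_assoc] at h1
      unfold Config.sentRight Config.sentLeft
      rw [h1, h2]
      generalize 2 ^ (T - (s + 1)) * pathCount s (y - x₀) = w
      split_ifs <;> constructor <;> omega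
    constructor
    · change (c'.run s).sentRight (x - 1) + (c'.run s).sentLeft (x + 1)
        = (c.run s).sentRight (x - 1) + (c.run s).sentLeft (x + 1) + _
      rw [(hstep _).1, (hstep _).2, pathCount, show x - x₀ - 1 = x - 1 - x₀ by ring,
        show x - x₀ + 1 = x + 1 - x₀ by ring]
      ring
    · obtain ⟨h1, h2⟩ := ih (by omega) x
      rw [Config.run_succ_arr, Config.run_succ_arr, h1, h2, hpow, mul_assoc, pow_add, pow_mul]
      simp

/-- The parities of the numbers of chips can be prescribed in a finite window and for finitely many
times. They are corrected one by one in the order of the times, and from left to right at each time: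
to correct the parity at `y` at time `s`, a pile of `2 ^ s` chips is added at `y + s`. -/
theorem exists_config_parity (arr₀ : ℤ → ℤˣ) (π : ℤ → ℕ → ℕ) (N T : ℕ) :
    ∃ c : Config, c.IsEven ∧ c.arr = arr₀ ∧ ∀ s < T, ∀ y : ℤ, -(N : ℤ) ≤ y → y < N →
      Even (y + s) → (c.run s).chips y % 2 = π y s % 2 := by
  induction T with
  | zero => exact ⟨⟨fun _ => 0, arr₀⟩, fun _ _ => rfl, rfl, fun s hs => absurd hs (by omega)⟩
  | succ T ih =>
    have key : ∀ j : ℕ, ∃ c : Config, c.IsEven ∧ c.arr = arr₀ ∧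
        (∀ s < T, ∀ y : ℤ, -(N : ℤ) ≤ y → y < N → Even (y + s) →
          (c.run s).chips y % 2 = π y s % 2) ∧
        ∀ y : ℤ, -(N : ℤ) ≤ y → y < -N + j → Even (y + T) →
          (c.run T).chips y % 2 = π y T % 2 := by
      intro j
      induction j with
      | zero =>
        obtain ⟨c, h1, h2, h3⟩ := ih
        exact ⟨c, h1, h2, h3, fun y h4 h5 => absurd h4 (by push_cast at h5; omega)⟩
      | succ j ihj =>
        obtain ⟨c, h1, h2, h3, h4⟩ := ihj
        by_cases hgood : Even (-(N : ℤ) + j + T) →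
            (c.run T).chips (-N + j) % 2 = π (-N + j) T % 2
        · refine ⟨c, h1, h2, h3, fun y hy1 hy2 hy3 => ?_⟩
          rcases eq_or_ne y (-N + j) with rfl | hne
          · exact hgood hy3
          · exact h4 y hy1 (by push_cast at hy2; omega) hy3
        · push Not at hgood
          obtain ⟨heven, hbad⟩ := hgood
          set x₀ : ℤ := -N + j + T with hx₀
          have hrun := c.run_add_pile ⟨fun x => c.chips x + 2 ^ T * pathCount 0 (x - x₀), c.arr⟩
            x₀ T (fun _ => rfl) rfl
          refine ⟨⟨fun x => c.chips x + 2 ^ T * pathCount 0 (x - x₀), c.arr⟩, ?_, h2, ?_, ?_⟩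
          · intro x hx
            have hne : x - x₀ ≠ 0 := by
              intro h0
              rw [sub_eq_zero.1 h0] at hx
              exact (Int.not_even_iff_odd.2 hx) heven
            simp [h1 x hx, pathCount, hne]
          · intro s hs y hy1 hy2 hy3
            rw [(hrun s hs.le y).1, ← h3 s hs y hy1 hy2 hy3,
              show T - s = T - s - 1 + 1 by omega, pow_succ', mul_assoc, Nat.add_mul_mod_self_left]
          · intro y hy1 hy2 hy3
            rw [(hrun T le_rfl y).1, Nat.sub_self, pow_zero, one_mul]
            rcases eq_or_ne y (-N + j) with rfl | hne
            · rw [show -(N : ℤ) + j - x₀ = -T by rw [hx₀]; ring, pathCount_neg]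
              omega
            · push_cast at hy2
              rw [pathCount_eq_zero T _ (by omega), add_zero]
              exact h4 y hy1 (by omega) hy3
    obtain ⟨c, h1, h2, h3, h4⟩ := key (2 * N)
    refine ⟨c, h1, h2, fun s hs y hy1 hy2 hy3 => ?_⟩
    rcases Nat.lt_succ_iff_lt_or_eq.1 hs with h | rfl
    · exact h3 s h y hy1 hy2 hy3
    · exact h4 y hy1 (by push_cast; omega) hy3

/-- The arrows can be prescribed in a finite window and for finitely many times, subject to the
condition that an even configuration imposes on the times of their turns. -/
theorem exists_config_arr (B : ℤ → ℕ → ℤˣ)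
    (hB : ∀ (y : ℤ) (s : ℕ), Odd (y + s) → B y (s + 1) = B y s) (N T : ℕ) :
    ∃ c : Config, c.IsEven ∧ ∀ s ≤ T, ∀ y : ℤ, -(N : ℤ) ≤ y → y < N →
      (c.run s).arr y = B y s := by
  obtain ⟨c, h1, h2, h3⟩ := exists_config_parity (fun y => B y 0)
    (fun y s => if B y (s + 1) = B y s then 0 else 1) N T
  refine ⟨c, h1, fun s => ?_⟩
  induction s with
  | zero =>
    intro _ y _ _
    rw [Config.run, h2]
  | succ s ih =>
    intro hs y hy1 hy2
    rw [Config.run_succ_arr, ih (by omega) y hy1 hy2]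
    rcases Int.even_or_odd (y + s) with he | ho
    · have h4 := h3 s (by omega) y hy1 hy2 he
      by_cases heq : B y (s + 1) = B y s
      · rw [if_pos heq] at h4
        rw [(Nat.even_iff.2 h4).neg_one_pow, one_mul, heq]
      · rw [if_neg heq] at h4
        rw [(Nat.odd_iff.2 h4).neg_one_pow]
        rcases Int.units_eq_one_or (B y s) with h5 | h5 <;>
          rcases Int.units_eq_one_or (B y (s + 1)) with h6 | h6 <;> simp_all
    · rw [c.run_chips_eq_zero 0 (fun x hx => h1 x (by simpa using hx)) s y (by simpa using ho),
        pow_zero, one_mul, hB y s ho]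

/-! ### The lower bound -/

/-- Signs chosen greedily make the squared norm of a signed sum of vectors at least the sum of the
squared norms. -/
theorem exists_signs {ι κ : Type*} [DecidableEq ι] (J : Finset ι) (K : Finset κ) (v : κ → ℝ)
    (f : ι → κ → ℝ) :
    ∃ ε : ι → ℤˣ, ∑ k ∈ K, ∑ j ∈ J, f j k ^ 2
      ≤ ∑ k ∈ K, (v k + ∑ j ∈ J, ((ε j : ℤ) : ℝ) * f j k) ^ 2 := by
  induction J using Finset.induction_on with
  | empty => exact ⟨fun _ => 1, by simpa using Finset.sum_nonneg fun _ _ => sq_nonneg _⟩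
  | insert j J hj ih =>
    obtain ⟨ε, hε⟩ := ih
    set w : κ → ℝ := fun k => v k + ∑ i ∈ J, ((ε i : ℤ) : ℝ) * f i k with hw
    obtain ⟨e, he⟩ : ∃ e : ℤˣ, 0 ≤ ((e : ℤ) : ℝ) * ∑ k ∈ K, w k * f j k := by
      rcases le_total 0 (∑ k ∈ K, w k * f j k) with h | h
      · exact ⟨1, by simpa using h⟩
      · exact ⟨-1, by simpa using h⟩
    have he2 : ((e : ℤ) : ℝ) ^ 2 = 1 := by
      rcases Int.units_eq_one_or e with rfl | rfl <;> simp
    refine ⟨Function.update ε j e, ?_⟩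
    have h1 : ∀ k, v k + ∑ i ∈ insert j J, ((Function.update ε j e i : ℤ) : ℝ) * f i k
        = w k + ((e : ℤ) : ℝ) * f j k := by
      intro k
      rw [Finset.sum_insert hj, Function.update_self, hw]
      have : ∑ i ∈ J, ((Function.update ε j e i : ℤ) : ℝ) * f i k
          = ∑ i ∈ J, ((ε i : ℤ) : ℝ) * f i k := by
        refine Finset.sum_congr rfl fun i hi => ?_
        rw [Function.update_of_ne (by rintro rfl; exact hj hi)]
      rw [this]
      ring
    have h2 : ∑ k ∈ K, (w k + ((e : ℤ) : ℝ) * f j k) ^ 2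
        = ∑ k ∈ K, w k ^ 2 + 2 * (((e : ℤ) : ℝ) * ∑ k ∈ K, w k * f j k)
          + ∑ k ∈ K, f j k ^ 2 := by
      rw [Finset.mul_sum, Finset.mul_sum, ← Finset.sum_add_distrib, ← Finset.sum_add_distrib]
      refine Finset.sum_congr rfl fun k _ => ?_
      linear_combination (f j k ^ 2) * he2
    rw [Finset.sum_congr rfl fun k _ => congrArg (· ^ 2) (h1 k), h2,
      Finset.sum_congr rfl fun k _ => Finset.sum_insert (f := fun i => f i k ^ 2) hj,
      Finset.sum_add_distrib]
    linarith

/-- The remaining times at which arrows are turned in the construction: `0, 48², 48⁴, 48⁶, …`. -/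
def scaleTime (i : ℕ) : ℕ := if i = 0 then 0 else 2304 ^ i

/-- The lengths of the blocks on which the arrows agree: `1, 2, 2 * 48, 2 * 48², …`. For `i ≥ 1`
they lie between the square roots of `scaleTime (i - 1)` and of `scaleTime i`. -/
def scaleLength (i : ℕ) : ℕ := if i = 0 then 1 else 2 * 48 ^ (i - 1)

theorem scaleTime_succ (i : ℕ) : scaleTime (i + 1) = 2304 ^ (i + 1) := if_neg (by omega)

theorem scaleLength_succ (i : ℕ) : scaleLength (i + 1) = 2 * 48 ^ i := if_neg (by omega)

theorem scaleLength_pos (i : ℕ) : 0 < scaleLength i := by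
  unfold scaleLength
  split_ifs <;> positivity

theorem scaleTime_strictMono : StrictMono scaleTime := by
  refine strictMono_nat_of_lt_succ fun i => ?_
  rw [scaleTime_succ]
  unfold scaleTime
  split_ifs with h
  · positivity
  · exact Nat.pow_lt_pow_right (by norm_num) (by omega)

theorem even_scaleTime (i : ℕ) : Even (scaleTime i) := by
  unfold scaleTime
  split_ifs with h
  · exact Even.zero
  · exact Even.pow_of_ne_zero (by decide) h

theorem exists_le_scaleTime (u : ℕ) : ∃ i, u ≤ scaleTime i := ⟨u, scaleTime_strictMono.le_apply⟩

/-- The first scale whose time is at least `u`. -/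
def level (u : ℕ) : ℕ := Nat.find (exists_le_scaleTime u)

theorem level_eq_iff (u i : ℕ) : level u = i ↔ u ≤ scaleTime i ∧ ∀ j < i, scaleTime j < u := by
  unfold level
  rw [Nat.find_eq_iff]
  simp only [not_le]

theorem level_scaleTime (i : ℕ) : level (scaleTime i) = i :=
  (level_eq_iff _ _).2 ⟨le_rfl, fun _ hj => scaleTime_strictMono hj⟩

theorem level_scaleTime_succ (i : ℕ) : level (scaleTime i + 1) = i + 1 :=
  (level_eq_iff _ _).2 ⟨scaleTime_strictMono (Nat.lt_succ_self i), fun _ hj =>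
    Nat.lt_succ_of_le (scaleTime_strictMono.monotone (Nat.lt_succ_iff.1 hj))⟩

theorem level_succ (u : ℕ) (hu : ∀ i, scaleTime i ≠ u) : level (u + 1) = level u := by
  obtain ⟨h1, h2⟩ := (level_eq_iff u _).1 rfl
  refine (level_eq_iff _ _).2 ⟨?_, fun j hj => (h2 j hj).trans (Nat.lt_succ_self u)⟩
  exact Nat.succ_le_of_lt (lt_of_le_of_ne h1 (hu _).symm)

/-- The increments over the scales of a function of time. -/
def scaleIncr (φ : ℕ → ℝ) : ℕ → ℝ
  | 0 => φ (scaleTime 0)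
  | i + 1 => φ (scaleTime (i + 1)) - φ (scaleTime i)

/-- Summation by parts for an arrow that is turned at the scale times only. -/
theorem sum_level (A : ℕ → ℝ) (n : ℕ) (φ : ℕ → ℝ) :
    ∑ u ∈ Finset.range (scaleTime n + 1), (A (level (u + 1)) - A (level u)) / 2 * φ u
      = (A (n + 1) * φ (scaleTime n)
        - ∑ i ∈ Finset.range (n + 1), A i * scaleIncr φ i) / 2 := by
  have h1 : ∑ u ∈ Finset.range (scaleTime n + 1), (A (level (u + 1)) - A (level u)) / 2 * φ u
      = ∑ i ∈ Finset.range (n + 1), (A (i + 1) - A i) / 2 * φ (scaleTime i) := by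
    have h2 : ∑ i ∈ Finset.range (n + 1), (A (i + 1) - A i) / 2 * φ (scaleTime i)
        = ∑ u ∈ (Finset.range (n + 1)).image scaleTime,
          (A (level (u + 1)) - A (level u)) / 2 * φ u := by
      rw [Finset.sum_image scaleTime_strictMono.injective.injOn]
      refine Finset.sum_congr rfl fun i _ => ?_
      rw [level_scaleTime, level_scaleTime_succ]
    rw [h2]
    symm
    refine Finset.sum_subset ?_ ?_
    · intro u hu
      obtain ⟨i, hi, rfl⟩ := Finset.mem_image.1 hu
      rw [Finset.mem_range] at hi ⊢
      exact Nat.lt_succ_of_le (scaleTime_strictMono.monotone (Nat.lt_succ_iff.1 hi))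
    · intro u hu1 hu2
      rw [level_succ, sub_self, zero_div, zero_mul]
      rintro i rfl
      rw [Finset.mem_range, Nat.lt_succ_iff] at hu1
      exact hu2 (Finset.mem_image_of_mem _ (Finset.mem_range.2
        (Nat.lt_succ_of_le (scaleTime_strictMono.le_iff_le.1 hu1))))
  rw [h1]
  clear h1
  induction n with
  | zero => simp [scaleIncr]; ring
  | succ n ih =>
    rw [Finset.sum_range_succ, ih, Finset.sum_range_succ _ (n + 1), scaleIncr]
    ring

/-- The weight with which an arrow at distance `z` at scale `i` enters a potential. -/
noncomputable def kernel (i : ℕ) (z : ℤ) : ℝ := scaleIncr (fun u => H z u) i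

/-- The combination of the values of a potential at the ends of an interval that gives twice the
discrepancy. -/
def endDiff (L : ℕ) (g : ℤ → ℝ) (b : ℤ) : ℝ := g (b - 1) + g b - g (b + L - 1) - g (b + L)

/-- The coefficient in the discrepancy of the interval of length `L` at `b` of the sign of the block
number `j.2` of scale `j.1`. -/
noncomputable def coeff (S : Finset ℤ) (L : ℕ) (j : ℕ × ℤ) (b : ℤ) : ℝ :=
  -(1 / 4) * ∑ y ∈ S.filter (fun y => Even y ∧ y / (scaleLength j.1 : ℤ) = j.2),
    endDiff L (fun z => kernel j.1 (z - y)) b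

/-- The arrow at `y` after the turn at scale `i`, given by the sign of the block of `y`. From scale
`n + 1` on it is the initial arrow, which points to the right. -/
def signAt (ε : ℕ × ℤ → ℤˣ) (n : ℕ) (y : ℤ) (i : ℕ) : ℤˣ :=
  if i ≤ n then ε (i, y / (scaleLength i : ℤ)) else 1

/-- Every choice of signs for the blocks is realized by arrows of an even configuration, with the
arrows at the odd vertices never turning. -/
theorem exists_config_of_signs (ε : ℕ × ℤ → ℤˣ) (n N : ℕ) :
    ∃ c : Config, c.IsEven ∧ ∀ y ∈ Finset.Icc (-(N : ℤ)) N, ∀ φ : ℕ → ℝ,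
      ∑ s ∈ Finset.range (scaleTime n + 1), c.turn y s * φ (scaleTime n + 1 - 1 - s)
        = if Even y then (φ (scaleTime n)
          - ∑ i ∈ Finset.range (n + 1), ((signAt ε n y i : ℤ) : ℝ) * scaleIncr φ i) / 2 else 0 := by
  set t := scaleTime n + 1 with ht
  have htodd : Odd t := (even_scaleTime n).add_one
  obtain ⟨c, hc, harr⟩ := exists_config_arr
    (fun y s => if Even y then signAt ε n y (level (t - s)) else 1) (by
      intro y s hys
      by_cases hy : Even y
      · simp only [if_pos hy]
        have hs : Odd s := by
          rw [Int.odd_iff] at hys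
          rw [Int.even_iff] at hy
          rw [Nat.odd_iff]
          omega
        rcases Nat.lt_or_ge s t with h | h
        · rw [show t - s = t - (s + 1) + 1 by omega, level_succ]
          intro i hi
          have := even_scaleTime i
          rw [hi] at this
          rw [Nat.odd_iff] at hs htodd
          rw [Nat.even_iff] at this
          omega
        · rw [show t - s = t - (s + 1) by omega]
      · simp only [if_neg hy]) (N + 1) t
  refine ⟨c, hc, fun y hy φ => ?_⟩
  rw [Finset.mem_Icc] at hy
  have harr' : ∀ s ≤ t, (c.run s).arr y = if Even y then signAt ε n y (level (t - s)) else 1 :=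
    fun s hs => harr s hs y (by push_cast; omega) (by push_cast; omega)
  split_ifs with hev
  · simp only [if_pos hev] at harr'
    have h := sum_level (fun i => ((signAt ε n y i : ℤ) : ℝ)) n φ
    have hlast : signAt ε n y (n + 1) = 1 := if_neg (by omega)
    simp only [hlast, Units.val_one, Int.cast_one, one_mul] at h
    rw [← h, ← Finset.sum_range_reflect]
    refine Finset.sum_congr rfl fun u hu => ?_
    rw [Finset.mem_range] at hu
    unfold Config.turn
    rw [harr' _ (by omega), harr' _ (by omega), show t - (t - 1 - u) = u + 1 by omega,
      show t - (t - 1 - u + 1) = u by omega, show t - 1 - (t - 1 - u) = u by omega]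
  · simp only [if_neg hev] at harr'
    refine Finset.sum_eq_zero fun s hs => ?_
    rw [Finset.mem_range] at hs
    unfold Config.turn
    rw [harr' _ (by omega), harr' _ (by omega), sub_self, zero_div, zero_mul]

/-- The discrepancy is the signed sum of the coefficients, up to a term independent of the signs. -/
theorem exists_config_disc_eq (n N L : ℕ) :
    ∃ v : ℤ → ℝ, ∀ ε : ℕ × ℤ → ℤˣ, ∃ c : Config, c.IsEven ∧
      ∀ b : ℤ, Finset.Icc (b - (scaleTime n + 1 : ℕ)) (b + L + (scaleTime n + 1 : ℕ))
          ⊆ Finset.Icc (-(N : ℤ)) N →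
        c.disc (interval b L) (scaleTime n + 1) = v b
          + ∑ j ∈ Finset.range (n + 1) ×ˢ Finset.Icc (-(N : ℤ)) N,
            ((ε j : ℤ) : ℝ) * coeff (Finset.Icc (-(N : ℤ)) N) L j b := by
  set S := Finset.Icc (-(N : ℤ)) N with hS
  refine ⟨fun b => 1 / 4 * ∑ y ∈ S with Even y,
    endDiff L (fun z => H (z - y) (scaleTime n)) b, fun ε => ?_⟩
  obtain ⟨c, hc, hturn⟩ := exists_config_of_signs ε n N
  refine ⟨c, hc, fun b hb => ?_⟩
  have hpot : ∀ z, c.potential S (scaleTime n + 1) z = ∑ y ∈ S with Even y,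
      (H (z - y) (scaleTime n)
        - ∑ i ∈ Finset.range (n + 1), ((signAt ε n y i : ℤ) : ℝ) * kernel i (z - y)) / 2 := by
    intro z
    rw [Finset.sum_filter]
    exact Finset.sum_congr rfl fun y hy => hturn y hy fun u => H (z - y) u
  have hfiber : ∀ i ∈ Finset.range (n + 1), ∑ q ∈ S, ((ε (i, q) : ℤ) : ℝ) * coeff S L (i, q) b
      = -(1 / 4) * ∑ y ∈ S with Even y,
        ((signAt ε n y i : ℤ) : ℝ) * endDiff L (fun z => kernel i (z - y)) b := by
    intro i hi
    rw [Finset.mem_range, Nat.lt_succ_iff] at hi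
    have hmaps : ∀ y ∈ S.filter Even, y / (scaleLength i : ℤ) ∈ S := by
      intro y hy
      have h1 := (Finset.mem_filter.1 hy).1
      have hpos : (1 : ℤ) ≤ scaleLength i := by exact_mod_cast scaleLength_pos i
      rw [hS, Finset.mem_Icc] at h1 ⊢
      constructor
      · rw [Int.le_ediv_iff_mul_le (by omega)]
        nlinarith
      · rw [← Int.lt_add_one_iff, Int.ediv_lt_iff_lt_mul (by omega)]
        nlinarith
    rw [← Finset.sum_fiberwise_of_maps_to hmaps, Finset.mul_sum]
    refine Finset.sum_congr rfl fun q _ => ?_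
    rw [Finset.filter_filter, coeff, Finset.mul_sum, Finset.mul_sum, Finset.mul_sum]
    refine Finset.sum_congr rfl fun y hy => ?_
    rw [signAt, if_pos hi, (Finset.mem_filter.1 hy).2.2]
    ring
  rw [c.disc_interval S _ b L hb, sum_interval_sub, Finset.sum_product,
    Finset.sum_congr rfl hfiber, ← Finset.mul_sum, Finset.sum_comm]
  simp only [hpot]
  rw [Finset.mul_sum, Finset.mul_sum, ← Finset.sum_add_distrib, ← Finset.sum_add_distrib,
    ← Finset.sum_sub_distrib, ← Finset.sum_sub_distrib, Finset.sum_div]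
  refine Finset.sum_congr rfl fun y _ => ?_
  simp only [endDiff, mul_add, mul_sub, Finset.sum_add_distrib, Finset.sum_sub_distrib]
  ring

theorem kernel_eq_zero_of_odd (i : ℕ) (z : ℤ) (hz : Odd z) : kernel i z = 0 := by
  have h : ∀ k, H z (scaleTime k) = 0 := by
    intro k
    refine H_eq_zero_of_odd _ _ (hz.add_even ?_)
    exact_mod_cast even_scaleTime k
  cases i with
  | zero => exact h 0
  | succ i => simp only [kernel, scaleIncr, h, sub_self]

theorem kernel_eq_zero_of_lt (i : ℕ) (z : ℤ) (hz : (scaleTime i : ℤ) < z) : kernel i z = 0 := by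
  have h : ∀ k ≤ i, H z (scaleTime k) = 0 := by
    intro k hk
    refine H_eq_zero _ _ ?_
    have : scaleTime k ≤ scaleTime i := scaleTime_strictMono.monotone hk
    exact lt_of_lt_of_le (by omega) (le_abs_self z)
  cases i with
  | zero => exact h 0 le_rfl
  | succ i => simp only [kernel, scaleIncr, h i (by omega), h (i + 1) le_rfl, sub_self]

/-- An even vertex far from the right end of the interval is only seen from the even one of the two
vertices at the left end. -/
theorem endDiff_kernel (i L : ℕ) (b y : ℤ) (hy : Even y) (h : (scaleTime i : ℤ) < b + L - 1 - y) :
    endDiff L (fun z => kernel i (z - y)) b = kernel i (2 * (b / 2) - y) := by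
  unfold endDiff
  beta_reduce
  rw [kernel_eq_zero_of_lt i (b + L - 1 - y) h, kernel_eq_zero_of_lt i (b + L - y) (by omega),
    sub_zero, sub_zero]
  rw [Int.even_iff] at hy
  rcases Int.even_or_odd b with hb | hb
  · rw [Int.even_iff] at hb
    rw [kernel_eq_zero_of_odd i (b - 1 - y) (by rw [Int.odd_iff]; omega), zero_add,
      show 2 * (b / 2) = b by omega]
  · rw [Int.odd_iff] at hb
    rw [kernel_eq_zero_of_odd i (b - y) (by rw [Int.odd_iff]; omega), add_zero,
      show 2 * (b / 2) = b - 1 by omega]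

theorem scaleTime_le_sq (i : ℕ) : (scaleTime i : ℝ) ≤ (48 ^ i) ^ 2 := by
  unfold scaleTime
  split_ifs with h
  · simp [h]
  · push_cast
    rw [← pow_mul, mul_comm, pow_mul]
    norm_num

/-- On an interval of three blocks of scale `i + 1` about `p`, the walk until the time of scale `i`
has most of its mass, by Chebyshev's inequality, and that until the time of scale `i + 1` has little,
by the local bound. -/
theorem sum_kernel_le (i : ℕ) (p lo : ℤ)
    (hlo : lo + scaleLength (i + 1) ≤ p) (hhi : p < lo + 2 * scaleLength (i + 1)) :
    ∑ y ∈ Finset.Ico lo (lo + 3 * scaleLength (i + 1)), kernel (i + 1) (p - y) ≤ -(1 / 2) := by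
  set l := scaleLength (i + 1) with hl
  set W := Finset.Ico lo (lo + 3 * (l : ℤ)) with hW
  have hlr : (l : ℝ) = 2 * 48 ^ i := by
    rw [hl, scaleLength_succ]
    push_cast
    rfl
  have hpow : (0 : ℝ) < 48 ^ i := by positivity
  have h1 : ∑ y ∈ W, H (p - y) (scaleTime (i + 1)) ≤ 1 / 4 := by
    have hpt : ∀ y ∈ W, H (p - y) (scaleTime (i + 1)) ≤ 2 / 48 ^ (i + 1) := by
      intro y _
      have h := H_local_bound (p - y) (scaleTime (i + 1))
      have h0 := H_nonneg (p - y) (scaleTime (i + 1))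
      have e : (scaleTime (i + 1) : ℝ) = (48 ^ (i + 1)) ^ 2 := by
        rw [scaleTime_succ]
        push_cast
        rw [← pow_mul, mul_comm (i + 1), pow_mul]
        norm_num
      rw [e] at h
      rw [le_div_iff₀ (by positivity)]
      refine (abs_le_of_sq_le_sq' (b := 2) ?_ (by norm_num)).2
      nlinarith [sq_nonneg (H (p - y) (scaleTime (i + 1)))]
    refine (Finset.sum_le_sum hpt).trans ?_
    rw [Finset.sum_const, hW, Int.card_Ico, nsmul_eq_mul,
      show (lo + 3 * (l : ℤ) - lo).toNat = 3 * l by omega]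
    push_cast
    rw [hlr, pow_succ]
    refine le_of_eq ?_
    field_simp
    norm_num
  have h2 : 3 / 4 ≤ ∑ y ∈ W, H (p - y) (scaleTime i) := by
    set u := scaleTime i with hu
    set S := W ∪ Finset.Icc (p - u) (p + u) with hS
    have hmass := sum_H S p u Finset.subset_union_right
    have hvar := sum_sq_mul_H S p p u Finset.subset_union_right
    have hpt : ∀ y ∈ S, H (y - p) u - ((y : ℝ) - p) ^ 2 * H (y - p) u / (l : ℝ) ^ 2
        ≤ if y ∈ W then H (p - y) u else 0 := by
      intro y _
      have h0 := H_nonneg (y - p) u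
      have hl0 : (0 : ℝ) < l := by rw [hlr]; positivity
      split_ifs with hy
      · rw [← H_neg (y - p) u, neg_sub]
        have := H_nonneg (p - y) u
        have : 0 ≤ ((y : ℝ) - p) ^ 2 * H (p - y) u / (l : ℝ) ^ 2 := by positivity
        linarith
      · have hfar : (l : ℝ) ^ 2 ≤ ((y : ℝ) - p) ^ 2 := by
          rw [hW, Finset.mem_Ico] at hy
          have hz : (l : ℤ) ≤ |y - p| := by
            rw [le_abs]
            omega
          have hz' : (l : ℝ) ≤ |(y : ℝ) - p| := by exact_mod_cast hz
          rw [← sq_abs ((y : ℝ) - p)]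
          gcongr
        rw [sub_nonpos, le_div_iff₀ (by positivity), mul_comm]
        gcongr
    have hsum := Finset.sum_le_sum hpt
    rw [Finset.sum_sub_distrib, ← Finset.sum_div, hmass, hvar, Finset.sum_ite_mem,
      Finset.inter_eq_right.2 Finset.subset_union_left, sub_self] at hsum
    have hq : (u : ℝ) / (l : ℝ) ^ 2 ≤ 1 / 4 := by
      rw [hlr, div_le_iff₀ (by positivity)]
      have := scaleTime_le_sq i
      rw [← hu] at this
      linarith
    have : ((0 : ℝ) ^ 2 + u) / (l : ℝ) ^ 2 = u / (l : ℝ) ^ 2 := by norm_num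
    linarith
  simp only [kernel, scaleIncr, Finset.sum_sub_distrib]
  linarith

/-- Each scale contributes at least a constant to the sum of the squared coefficients. -/
theorem le_sum_coeff_sq (n i L N : ℕ) (b : ℤ) (hi : i ≤ n) (hL : 2 * 2304 ^ n ≤ L) (hb0 : 0 ≤ b)
    (hbN : b + 4 * L < N) :
    1 / 192 ≤ ∑ q ∈ Finset.Icc (-(N : ℤ)) N, coeff (Finset.Icc (-(N : ℤ)) N) L (i, q) b ^ 2 := by
  set S := Finset.Icc (-(N : ℤ)) N with hS
  set p : ℤ := 2 * (b / 2) with hp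
  have hpb : p ≤ b ∧ b ≤ p + 1 := by omega
  cases i with
  | zero =>
    have hL2 : 2 ≤ L := le_trans (by have := Nat.one_le_pow n 2304 (by norm_num); omega) hL
    have hpS : p ∈ S := by
      rw [hS, Finset.mem_Icc]
      omega
    refine le_trans ?_ (Finset.single_le_sum (fun q _ => sq_nonneg _) hpS)
    have hfil : S.filter (fun y => Even y ∧ y / (scaleLength 0 : ℤ) = p) = {p} := by
      ext y
      simp only [Finset.mem_filter, Finset.mem_singleton, scaleLength, if_true, Nat.cast_one,
        Int.ediv_one]
      constructor
      · exact fun h => h.2.2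
      · rintro rfl
        exact ⟨hpS, even_two_mul _, rfl⟩
    rw [coeff, hfil, Finset.sum_singleton, endDiff_kernel 0 L b p (even_two_mul _) (by
      simp only [scaleTime, if_true, Nat.cast_zero]
      omega)]
    simp only [← hp, sub_self, kernel, scaleIncr, scaleTime, if_true, H_zero]
    norm_num
  | succ i =>
    set l := scaleLength (i + 1) with hl
    have hl0 : (0 : ℤ) < l := by exact_mod_cast scaleLength_pos (i + 1)
    have hpow1 : 2304 ^ (i + 1) ≤ 2304 ^ n := Nat.pow_le_pow_right (by norm_num) hi
    have hpow2 : 48 ^ i ≤ 2304 ^ i := Nat.pow_le_pow_left (by norm_num) i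
    have hpow3 : 0 < 48 ^ i := by positivity
    have hlL : 16 * (l : ℤ) + 16 < scaleTime (i + 1) ∧ 2 * (scaleTime (i + 1) : ℤ) ≤ L := by
      rw [hl, scaleLength_succ, scaleTime_succ]
      rw [pow_succ] at hpow1 ⊢
      generalize 2304 ^ n = P at *
      generalize 2304 ^ i = Q at *
      generalize 48 ^ i = R at *
      push_cast
      omega
    set q₀ : ℤ := p / l with hq₀
    have hq1 : q₀ * l ≤ p := Int.ediv_mul_le p hl0.ne'
    have hq2 : p < (q₀ + 1) * l := Int.lt_ediv_add_one_mul_self p hl0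
    have hq3 : 0 ≤ q₀ := Int.ediv_nonneg (by omega) hl0.le
    have hq4 : q₀ ≤ p := Int.ediv_le_self _ (by omega)
    set lo : ℤ := (q₀ - 1) * l with hlo
    have hlo1 : lo + l ≤ p := by rw [hlo]; linarith
    have hlo2 : p < lo + 2 * l := by rw [hlo]; linarith
    set Q : Finset ℤ := Finset.Icc (q₀ - 1) (q₀ + 1) with hQ
    have hQS : Q ⊆ S := Finset.Icc_subset_Icc (by omega) (by omega)
    set W : Finset ℤ := Finset.Ico lo (lo + 3 * l) with hW
    have hblock : ∀ y : ℤ, y / (l : ℤ) ∈ Q ↔ y ∈ W := by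
      intro y
      rw [hQ, hW, Finset.mem_Icc, Finset.mem_Ico, Int.le_ediv_iff_mul_le hl0,
        show lo + 3 * (l : ℤ) = (q₀ + 1 + 1) * l by rw [hlo]; ring,
        ← Int.ediv_lt_iff_lt_mul hl0, Int.lt_add_one_iff, hlo]
    have hWS : ∀ y ∈ W, y ∈ S := by
      intro y hy
      rw [hW, Finset.mem_Ico] at hy
      rw [hS, Finset.mem_Icc]
      omega
    have hsum : ∑ q ∈ Q, coeff S L (i + 1, q) b
        = -(1 / 4) * ∑ y ∈ W, kernel (i + 1) (p - y) := by
      have h1 : ∑ y ∈ W, kernel (i + 1) (p - y) = ∑ y ∈ W with Even y, kernel (i + 1) (p - y) := by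
        symm
        refine Finset.sum_filter_of_ne fun y _ hne => ?_
        by_contra hodd
        rw [Int.not_even_iff_odd] at hodd
        exact hne (kernel_eq_zero_of_odd _ _ ((even_two_mul _).sub_odd hodd))
      rw [h1, ← Finset.sum_fiberwise_of_maps_to (t := Q) (g := fun y => y / (l : ℤ))
        (fun y hy => (hblock y).2 (Finset.mem_filter.1 hy).1), Finset.mul_sum]
      refine Finset.sum_congr rfl fun q hq => ?_
      have hfil : S.filter (fun y => Even y ∧ y / (l : ℤ) = q)
          = (W.filter Even).filter (fun y => y / (l : ℤ) = q) := by
        ext y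
        simp only [Finset.mem_filter]
        constructor
        · rintro ⟨_, h2, h3⟩
          exact ⟨⟨(hblock y).1 (h3 ▸ hq), h2⟩, h3⟩
        · rintro ⟨⟨h2, h3⟩, h4⟩
          exact ⟨hWS y h2, h3, h4⟩
      rw [coeff, hfil]
      congr 1
      refine Finset.sum_congr rfl fun y hy => ?_
      have hy' := (Finset.mem_filter.1 (Finset.mem_filter.1 hy).1)
      have hyW := Finset.mem_Ico.1 hy'.1
      exact endDiff_kernel (i + 1) L b y hy'.2 (by omega)
    have hkey := sum_kernel_le i p lo hlo1 hlo2
    have hcs := sq_sum_le_card_mul_sum_sq (s := Q) (f := fun q => coeff S L (i + 1, q) b)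
    rw [hsum, hQ, Int.card_Icc, show (q₀ + 1 + 1 - (q₀ - 1)).toNat = 3 by omega] at hcs
    refine le_trans ?_ (Finset.sum_le_sum_of_subset_of_nonneg hQS fun _ _ _ => sq_nonneg _)
    push_cast at hcs
    have : (1 / 8 : ℝ) ^ 2 ≤ (-(1 / 4) * ∑ y ∈ W, kernel (i + 1) (p - y)) ^ 2 := by
      refine pow_le_pow_left₀ (by norm_num) ?_ 2
      linarith
    linarith

/-- The lower bound in terms of the number of scales. -/
theorem exists_le_meanSqDisc (n L M : ℕ) (hL : 2 * 2304 ^ n ≤ L) (hM : 1 ≤ M) :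
    ∃ c : Config, c.IsEven ∧
      ((n : ℝ) + 1) / 192 ≤ c.meanSqDisc (interval 0 L) M (scaleTime n + 1) := by
  set N := M + 4 * L + 4 with hN
  have ht : scaleTime n + 1 ≤ L := by
    have h1 : 0 < 2304 ^ n := by positivity
    have h2 : scaleTime n ≤ 2304 ^ n := by
      unfold scaleTime
      split_ifs <;> omega
    omega
  obtain ⟨v, hv⟩ := exists_config_disc_eq n N L
  obtain ⟨ε, hε⟩ := exists_signs (Finset.range (n + 1) ×ˢ Finset.Icc (-(N : ℤ)) N)
    (Finset.Icc (1 : ℕ) M) (fun k => v k)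
    (fun j k => coeff (Finset.Icc (-(N : ℤ)) N) L j k)
  obtain ⟨c, hc, hdisc⟩ := hv ε
  refine ⟨c, hc, ?_⟩
  have hM0 : (0 : ℝ) < M := by exact_mod_cast hM
  rw [Config.meanSqDisc, one_div, le_inv_mul_iff₀ hM0]
  have hsum : ∑ k ∈ Finset.Icc (1 : ℕ) M,
        c.disc (translate (interval 0 L) (k : ℤ)) (scaleTime n + 1) ^ 2
      = ∑ k ∈ Finset.Icc (1 : ℕ) M, (v k
          + ∑ j ∈ Finset.range (n + 1) ×ˢ Finset.Icc (-(N : ℤ)) N,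
            ((ε j : ℤ) : ℝ) * coeff (Finset.Icc (-(N : ℤ)) N) L j k) ^ 2 := by
    refine Finset.sum_congr rfl fun k hk => ?_
    rw [Finset.mem_Icc] at hk
    rw [translate_interval, zero_add, hdisc]
    exact Finset.Icc_subset_Icc (by omega) (by omega)
  rw [hsum]
  refine le_trans ?_ hε
  have hk : ∀ k ∈ Finset.Icc (1 : ℕ) M, ((n : ℝ) + 1) / 192
      ≤ ∑ j ∈ Finset.range (n + 1) ×ˢ Finset.Icc (-(N : ℤ)) N,
        coeff (Finset.Icc (-(N : ℤ)) N) L j k ^ 2 := by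
    intro k hk
    rw [Finset.mem_Icc] at hk
    rw [Finset.sum_product]
    have h1 : ∑ _i ∈ Finset.range (n + 1), (1 / 192 : ℝ) = ((n : ℝ) + 1) / 192 := by
      rw [Finset.sum_const, Finset.card_range, nsmul_eq_mul]
      push_cast
      ring
    rw [← h1]
    refine Finset.sum_le_sum fun i hi => ?_
    exact le_sum_coeff_sq n i L N k (Nat.lt_succ_iff.1 (Finset.mem_range.1 hi)) hL (by omega)
      (by omega)
  refine le_trans (le_of_eq ?_) (Finset.sum_le_sum hk)
  rw [Finset.sum_const, Nat.card_Icc, Nat.add_sub_cancel, nsmul_eq_mul]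

/-- The number of scales that fit into `L` is of the order of `log L`. -/
theorem exists_scales (L : ℕ) (hL : 2 ≤ L) :
    ∃ n : ℕ, 2 * 2304 ^ n ≤ L ∧ Real.log L ≤ 4608 * ((n : ℝ) + 1) := by
  refine ⟨Nat.log 2304 (L / 2), ?_, ?_⟩
  · have := Nat.pow_log_le_self 2304 (x := L / 2) (by omega)
    omega
  · have h := Nat.lt_pow_succ_log_self (b := 2304) (by norm_num) (L / 2)
    generalize Nat.log 2304 (L / 2) = n at *
    have h1 : L ≤ 2304 ^ (n + 1 + 1) := by
      rw [pow_succ]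
      omega
    have h2 : (L : ℝ) ≤ 2304 ^ (n + 1 + 1) := by exact_mod_cast h1
    have h3 := Real.log_le_log (by positivity) h2
    rw [Real.log_pow] at h3
    have h4 := Real.log_le_sub_one_of_pos (show (0 : ℝ) < 2304 by norm_num)
    push_cast at h3
    have h5 : (0 : ℝ) ≤ n := by positivity
    nlinarith

end ProppMachine

theorem mainTheorem6 :
    (∃ C : ℝ, 0 < C ∧ ∀ L : ℕ, 2 ≤ L → ∀ M : ℕ, L ^ 6 < M →
      ∀ c : ProppMachine.Config, (c.IsEven ∨ c.IsOdd) → ∀ (t : ℕ) (a : ℤ),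
        c.meanSqDisc (ProppMachine.interval a L) M t ≤ C * Real.log L ∧
        √(c.meanSqDisc (ProppMachine.interval a L) M t) ≤ C * √(Real.log L)) ∧
    (∃ κ : ℝ, 0 < κ ∧ ∀ L : ℕ, 1 ≤ L → ∀ M : ℕ, 1 ≤ M →
      ∃ c : ProppMachine.Config, c.IsEven ∧ ∃ (t : ℕ) (a : ℤ),
        κ * Real.log L ≤ c.meanSqDisc (ProppMachine.interval a L) M t) := by
  constructor
  · refine ⟨600000, by norm_num, fun L hL M hM c hc t a => ?_⟩
    have hLM : L ≤ M := (Nat.le_self_pow (by norm_num) L).trans hM.le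
    have h := c.meanSqDisc_le hc t a L M hL hLM
    refine ⟨h, ?_⟩
    calc √(c.meanSqDisc (ProppMachine.interval a L) M t) ≤ √(600000 ^ 2 * Real.log L) := by
          refine Real.sqrt_le_sqrt (h.trans ?_)
          have := Real.log_natCast_nonneg L
          linarith
      _ = 600000 * √(Real.log L) := by
          rw [Real.sqrt_mul (by norm_num), Real.sqrt_sq (by norm_num)]
  · refine ⟨1 / (192 * 4608), by norm_num, fun L hL M hM => ?_⟩
    rcases eq_or_ne L 1 with rfl | hL1
    · refine ⟨⟨fun _ => 0, fun _ => 1⟩, fun _ _ => rfl, 0, 0, ?_⟩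
      rw [Nat.cast_one, Real.log_one, mul_zero]
      exact mul_nonneg (by positivity) (Finset.sum_nonneg fun _ _ => sq_nonneg _)
    · obtain ⟨n, hn, hlog⟩ := ProppMachine.exists_scales L (by omega)
      obtain ⟨c, hc, h⟩ := ProppMachine.exists_le_meanSqDisc n L M hn hM
      refine ⟨c, hc, _, 0, le_trans ?_ h⟩
      linarith
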